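/- **Setting.** Let $\mathcal S=\{1,\dots,S\}$ and $\mathcal A=\{1,\dots,A\}$ be nonempty finite sets of states and actions, $R:\mathcal S\times\mathcal A\times\mathcal S\to\mathbb R$ a reward function with $r_{s,a}=R(s,a,\cdot)\in\mathbb R^S$, $p_0$ an initial distribution on $\mathcal S$, and $\gamma\in[0,1)$. A transition function $P=(p_{s,a})_{s,a}$ assigns a probability vector $p_{s,a}\in\Delta^S$ to every $(s,a)$; a policy $\pi\in\Pi$ assigns a distribution $\pi(s)$ on $\mathcal A$ to every state $s$. Let $\rho(\pi,P)=\mathbb E\big[\sum_{t\ge0}\gamma^tR(s_t,a_t,s_{t+1})\big]$, where $s_0\sim p_0$, $a_t\sim\pi(s_t)$, $s_{t+1}\sim p_{s_t,a_t}$. For a real random variable $X$ let $\mathrm{VaR}_\alpha[X]=\sup\{t\in\mathbb R:\Pr[X\ge t]\ge1-\alpha\}$. Let $\Phi$ be the standard normal distribution function. For $N\in\mathbb N$ let $\tilde P_N$ be a random transition function (distributed according to the posterior after $N$ observations), and let $P^*$ be the true transition function. Assume that the posterior is asymptotically normal: $$\sqrt N\,(\tilde P_N-P^*)\rightsquigarrow\mathcal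 N(0,\Sigma)\qquad(N\to\infty)$$ jointly in all coordinates $(s,a,s')$, where $\Sigma$ is a positive semidefinite, possibly singular, matrix (the inverse Fisher information at $P^*$); let $\Sigma_{s,a}\in\mathbb R^{S\times S}$ be its diagonal block for $(s,a)$. Let $\delta\in(0,\tfrac12)$ and $\alpha=\delta/S$. Let $\rho^*_N=\max_{\pi\in\Pi}\mathrm{VaR}_\delta[\rho(\pi,\tilde P_N)]$ be the optimal percentile return. Let $\hat v_N\in\mathbb R^S$ be the fixed point of the VaR Bellman operator $$(\mathcal T_Nv)_s=\max_{a\in\mathcal A}\mathrm{VaR}_\alpha\big[\tilde p_{N,s,a}^{\top}(r_{s,a}+\gamma v)\big],$$ and put $\hat\rho_N=p_0^\top\hat v_N$, $\hat w_{N,s,a}=r_{s,a}+\gamma\hat v_N$ and $\sigma_{\max,N}^2=\max_{s,a}\hat w_{N,s,a}^\top\Sigma_{s,a}\hat w_{N,s,a}$. **Theorem (Asymptotic Performance).** For every $N$ the fixed point $\hat v_N$ exists and is unique, the limits $\sigma_{\max}=\lim_{N\to\infty}\sigma_{\max,N}$ and $\lim_{N\to\infty}\sqrt N(\rho^*_N-\hat\rho_N)$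 exist in $\mathbb R$, and $$\lim_{N\to\infty}\sqrt N\,(\rho^*_N-\hat\rho_N)\;\le\;\frac{2\,\Phi^{-1}(1-\delta/S)\,\sigma_{\max}}{1-\gamma}\;\le\;\frac{\sqrt{8\ln(S/\delta)}\,\sigma_{\max}}{1-\gamma}.$$ -/

import Mathlib

open MeasureTheory ProbabilityTheory Filter Topology
open scoped Matrix

noncomputable section

/-- Transition functions `(s, a) ↦ p_{s,a}` with values in the probability simplex. -/
abbrev Transition (S A : ℕ) : Type := Fin S → Fin A → stdSimplex ℝ (Fin S)

/-- Markovian (stationary, randomized) policies. -/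
abbrev Policy (S A : ℕ) : Type := Fin S → stdSimplex ℝ (Fin A)

/-- The measure on `Fin n` whose point masses are the coordinates of `p`. -/
def simplexMeasure {n : ℕ} (p : stdSimplex ℝ (Fin n)) : Measure (Fin n) :=
  ∑ i, ENNReal.ofReal (p i) • Measure.dirac i

instance {n : ℕ} (p : stdSimplex ℝ (Fin n)) : IsProbabilityMeasure (simplexMeasure p) where
  measure_univ := by
    have h : ∑ i, p.1 i = 1 := p.2.2
    have h' : ∑ i, ENNReal.ofReal (p.1 i) = 1 := by
      rw [← ENNReal.ofReal_sum_of_nonneg (fun i _ => p.2.1 i), h, ENNReal.ofReal_one]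
    simp only [simplexMeasure, Measure.finsetSum_apply, Measure.smul_apply, measure_univ,
      smul_eq_mul, mul_one]
    exact h'

/-- The policy as a Markov kernel from states to actions. -/
def policyKernel {S A : ℕ} (π : Policy S A) : Kernel (Fin S) (Fin A) :=
  Kernel.ofFunOfCountable fun s => simplexMeasure (π s)

instance {S A : ℕ} (π : Policy S A) : IsMarkovKernel (policyKernel π) where
  isProbabilityMeasure s := inferInstanceAs (IsProbabilityMeasure (simplexMeasure (π s)))

/-- One step `(s, a) ↦ (s', a')` of the controlled chain: `s' ∼ p_{s,a}`, then `a' ∼ π(s')`. -/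
def stepKernel {S A : ℕ} (π : Policy S A) (P : Transition S A) :
    Kernel (Fin S × Fin A) (Fin S × Fin A) :=
  Kernel.ofFunOfCountable fun x => simplexMeasure (P x.1 x.2) ⊗ₘ policyKernel π

instance {S A : ℕ} (π : Policy S A) (P : Transition S A) : IsMarkovKernel (stepKernel π P) where
  isProbabilityMeasure x :=
    inferInstanceAs (IsProbabilityMeasure (simplexMeasure (P x.1 x.2) ⊗ₘ policyKernel π))

/-- The step from time `n` to time `n + 1` as a kernel on histories up to time `n`; it depends on
the history only through its last entry. -/
def historyKernel {S A : ℕ} (π : Policy S A) (P : Transition S A) (n : ℕ) :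
    Kernel (Finset.Iic n → Fin S × Fin A) (Fin S × Fin A) :=
  (stepKernel π P).comap (fun h => h ⟨n, Finset.mem_Iic.2 le_rfl⟩) (measurable_pi_apply _)

instance {S A : ℕ} (π : Policy S A) (P : Transition S A) (n : ℕ) :
    IsMarkovKernel (historyKernel π P n) :=
  inferInstanceAs (IsMarkovKernel ((stepKernel π P).comap _ _))

/-- The law of the trajectory `((s_t, a_t))_t` with `s_0 ∼ p₀`, `a_t ∼ π(s_t)` and
`s_{t+1} ∼ P(s_t, a_t, ·)`. -/
def trajectoryLaw {S A : ℕ} (p₀ : stdSimplex ℝ (Fin S)) (π : Policy S A) (P : Transition S A) :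
    Measure (ℕ → Fin S × Fin A) :=
  Kernel.trajMeasure (X := fun _ => Fin S × Fin A)
    (simplexMeasure p₀ ⊗ₘ policyKernel π) (historyKernel π P)

/-- The expected discounted return `ρ(π, P)`. -/
def expectedReturn {S A : ℕ} (R : Fin S → Fin A → Fin S → ℝ) (p₀ : stdSimplex ℝ (Fin S)) (γ : ℝ)
    (π : Policy S A) (P : Transition S A) : ℝ :=
  ∫ ω, ∑' t : ℕ, γ ^ t * R (ω t).1 (ω t).2 (ω (t + 1)).1 ∂(trajectoryLaw p₀ π P)

/-- Value at risk: `VaR_α[X] = sup {t | Pr[X ≥ t] ≥ 1 - α}`. -/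
def valueAtRisk {Ω : Type*} [MeasurableSpace Ω] (μ : Measure Ω) (α : ℝ) (X : Ω → ℝ) : ℝ :=
  sSup {t : ℝ | 1 - α ≤ μ.real {ω | t ≤ X ω}}

/-- `w_{s,a} = r_{s,a} + γ v`. -/
def oneStepValue {S A : ℕ} (R : Fin S → Fin A → Fin S → ℝ) (γ : ℝ) (v : Fin S → ℝ)
    (s : Fin S) (a : Fin A) : Fin S → ℝ :=
  R s a + γ • v

/-- The VaR Bellman optimality operator
`(T v)_s = max_a VaR_α[p̃_{s,a}ᵀ (r_{s,a} + γ v)]`, where `P̃` has law `μ`. -/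
def varBellman {S A : ℕ} (R : Fin S → Fin A → Fin S → ℝ) (γ : ℝ) (μ : Measure (Transition S A))
    (α : ℝ) (v : Fin S → ℝ) : Fin S → ℝ :=
  fun s => ⨆ a : Fin A,
    valueAtRisk μ α fun P : Transition S A => (P s a : Fin S → ℝ) ⬝ᵥ oneStepValue R γ v s a

/-- The optimal percentile return `ρ* = max_π VaR_δ[ρ(π, P̃)]`, where `P̃` has law `μ`. -/
def optimalPercentileReturn {S A : ℕ} (R : Fin S → Fin A → Fin S → ℝ)
    (p₀ : stdSimplex ℝ (Fin S)) (γ : ℝ) (μ : Measure (Transition S A)) (δ : ℝ) : ℝ :=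
  ⨆ π : Policy S A, valueAtRisk μ δ (expectedReturn R p₀ γ π)

/-- The rescaled deviation `√N (P - P*)`, as a vector indexed by `(s, a, s')`. -/
def scaledDeviation {S A : ℕ} (Pstar : Transition S A) (N : ℕ) (P : Transition S A) :
    EuclideanSpace ℝ (Fin S × Fin A × Fin S) :=
  WithLp.toLp 2 fun x => √(N : ℝ) * (P x.1 x.2.1 x.2.2 - Pstar x.1 x.2.1 x.2.2)

/-- The block of a covariance matrix that belongs to the transition vector of `(s, a)`. -/
def covBlock {S A : ℕ} (C : Matrix (Fin S × Fin A × Fin S) (Fin S × Fin A × Fin S) ℝ)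
    (s : Fin S) (a : Fin A) : Matrix (Fin S) (Fin S) ℝ :=
  C.submatrix (fun s' => (s, a, s')) (fun s' => (s, a, s'))

/-- The square root of `max_{s,a} w_{s,a}ᵀ C_{s,a} w_{s,a}`, where `w_{s,a} = r_{s,a} + γ v`. -/
def sigmaMax {S A : ℕ} (R : Fin S → Fin A → Fin S → ℝ) (γ : ℝ)
    (C : Matrix (Fin S × Fin A × Fin S) (Fin S × Fin A × Fin S) ℝ) (v : Fin S → ℝ) : ℝ :=
  √(⨆ x : Fin S × Fin A,
    oneStepValue R γ v x.1 x.2 ⬝ᵥ (covBlock C x.1 x.2 *ᵥ oneStepValue R γ v x.1 x.2))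

/-- The quantile function `Φ⁻¹` of the standard normal distribution. -/
def stdNormalQuantile (q : ℝ) : ℝ :=
  sInf {x : ℝ | q ≤ cdf (gaussianReal 0 1) x}

end

/-! Let `vstar` be the optimal value function of `Pstar`. Both quantities are centred at `p₀ ⬝ᵥ
vstar`, and the two scaled errors have separate limits.

Value at risk: if `√N (X - b)` is a linear functional of the scaled deviation whose slope tends to
`c₀` as `P → Pstar`, then the scaled VaR tends to `-Φ⁻¹(1 - α) √(c₀ᵀ C c₀)`
(`tendsto_sqrt_mul_valueAtRisk_sub`).

Percentile return: `√N (VaR - p₀ᵀ vstar)` for a policy is `√N d + h_N`, where `d ≤ 0` is its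
suboptimality under `Pstar` and `h_N` converges to a nonpositive limit because `δ < 1/2`. On the
compact policy space only policies with `d = 0` survive (`tendsto_iSup_sqrt_mul_add`), so the limit
of the maxima is `≤ 0`.

VaR fixed point: `√N (vhat N - vstar)` is itself a fixed point of a `γ`-contraction. These
contractions converge pointwise, hence so do their fixed points (`tendsto_fixedPoint`). A minimum
principle bounds the limit below by `-Φ⁻¹(1 - α) σ / (1 - γ)`.

Subtracting gives the bound even without the factor 2. The logarithmic bound is Chernoff's
inequality for the normal tail. -/

/-! ### Value at risk -/

section ValueAtRisk

variable {Ω : Type*} [MeasurableSpace Ω] {μ : Measure Ω} {α : ℝ} {X Y : Ω → ℝ}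

theorem le_of_mem_valueAtRisk_set [IsProbabilityMeasure μ] {t b : ℝ}
    (hb : μ.real {ω | b ≤ X ω} < 1 - α) (ht : 1 - α ≤ μ.real {ω | t ≤ X ω}) : t ≤ b := by
  by_contra h
  have : μ.real {ω | t ≤ X ω} ≤ μ.real {ω | b ≤ X ω} :=
    measureReal_mono fun ω hω => (not_le.1 h).le.trans hω
  linarith

/-- The two tail conditions also make the defining set nonempty and bounded above, so that its
`sSup` is a genuine supremum. -/
theorem valueAtRisk_mem_Icc [IsProbabilityMeasure μ] {a b : ℝ}
    (ha : 1 - α ≤ μ.real {ω | a ≤ X ω}) (hb : μ.real {ω | b ≤ X ω} < 1 - α) :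
    valueAtRisk μ α X ∈ Set.Icc a b :=
  ⟨le_csSup ⟨b, fun _ ht => le_of_mem_valueAtRisk_set hb ht⟩ ha,
    csSup_le ⟨a, ha⟩ fun _ ht => le_of_mem_valueAtRisk_set hb ht⟩

theorem measureReal_le_of_forall_lt {b t : ℝ} (hX : ∀ ω, X ω ≤ b) (ht : b < t) :
    μ.real {ω | t ≤ X ω} = 0 := by
  have : {ω | t ≤ X ω} = ∅ := by
    ext ω
    simp [(hX ω).trans_lt ht]
  simp [this]

theorem measureReal_le_of_forall_ge [IsProbabilityMeasure μ] {a : ℝ} (hX : ∀ ω, a ≤ X ω) :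
    μ.real {ω | a ≤ X ω} = 1 := by
  simp [hX]

/-- VaR is monotone and commutes with adding constants. The bound `B` only keeps the defining sets
nonempty and bounded above. -/
theorem valueAtRisk_le_add [IsProbabilityMeasure μ] (hα0 : 0 ≤ α) (hα1 : α < 1) {B c : ℝ}
    (hX : ∀ ω, |X ω| ≤ B) (hY : ∀ ω, |Y ω| ≤ B) (hXY : ∀ ω, X ω ≤ Y ω + c) :
    valueAtRisk μ α X ≤ valueAtRisk μ α Y + c := by
  refine csSup_le ⟨-B, ?_⟩ fun t ht => ?_
  · have := measureReal_le_of_forall_ge (μ := μ) fun ω => (abs_le.1 (hX ω)).1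
    simp only [Set.mem_ofPred_eq, this]
    linarith
  · rw [← sub_le_iff_le_add]
    refine le_csSup ⟨B + 1, fun u hu => le_of_mem_valueAtRisk_set (μ := μ) ?_ hu⟩ ?_
    · rw [measureReal_le_of_forall_lt (fun ω => (abs_le.1 (hY ω)).2) (lt_add_one B)]
      linarith
    · refine ht.trans (measureReal_mono fun ω hω => ?_)
      have := hXY ω
      simp only [Set.mem_ofPred_eq] at hω ⊢
      linarith

theorem valueAtRisk_le [IsProbabilityMeasure μ] (hα0 : 0 ≤ α) (hα1 : α < 1) {B : ℝ}
    (hX : ∀ ω, |X ω| ≤ B) : valueAtRisk μ α X ≤ B + 1 := by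
  refine (valueAtRisk_mem_Icc (a := -B) ?_ ?_).2
  · rw [measureReal_le_of_forall_ge fun ω => (abs_le.1 (hX ω)).1]
    linarith
  · rw [measureReal_le_of_forall_lt (fun ω => (abs_le.1 (hX ω)).2) (lt_add_one B)]
    linarith

end ValueAtRisk

/-! ### Quantiles of normal distributions -/

section Quantile

theorem stdNormal_real_Ici_neg (x : ℝ) :
    (gaussianReal 0 1).real (Set.Ici (-x)) = cdf (gaussianReal 0 1) x := by
  have h : (gaussianReal 0 1).map (fun y : ℝ => -y) = gaussianReal 0 1 := by
    simpa using gaussianReal_map_neg (μ := 0) (v := 1)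
  calc (gaussianReal 0 1).real (Set.Ici (-x))
      = ((gaussianReal 0 1).map (fun y : ℝ => -y)).real (Set.Ici (-x)) := by rw [h]
    _ = (gaussianReal 0 1).real ((fun y : ℝ => -y) ⁻¹' Set.Ici (-x)) :=
        map_measureReal_apply (by fun_prop) measurableSet_Ici
    _ = cdf (gaussianReal 0 1) x := by
        rw [cdf_eq_real]
        congr 1
        ext y
        simp

theorem cdf_stdNormal_lt {x y : ℝ} (hxy : x < y) :
    cdf (gaussianReal 0 1) x < cdf (gaussianReal 0 1) y := by
  have : 0 < (gaussianReal 0 1).real (Set.Ioc x y) := by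
    rw [measureReal_def, ENNReal.toReal_pos_iff]
    refine ⟨pos_iff_ne_zero.2 fun h => ?_, measure_lt_top _ _⟩
    have := gaussianReal_absolutelyContinuous' 0 (one_ne_zero) h
    simp only [Real.volume_Ioc, ENNReal.ofReal_eq_zero] at this
    linarith
  rw [cdf_eq_real, cdf_eq_real, ← Set.Iic_union_Ioc_eq_Iic hxy.le,
    measureReal_union (Set.Iic_disjoint_Ioc le_rfl) measurableSet_Ioc]
  linarith

/-- Since `q > 0`, the set defining the quantile is bounded below. In the converse below, `q < 1`
makes it nonempty and strict monotonicity of the cdf gives the strict inequality. -/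
theorem cdf_stdNormal_lt_of_lt_quantile {q x : ℝ} (hq : 0 < q)
    (hx : x < stdNormalQuantile q) : cdf (gaussianReal 0 1) x < q := by
  by_contra! h
  obtain ⟨y, hy⟩ :=
    ((tendsto_cdf_atBot (gaussianReal 0 1)).eventually_lt_const hq).exists_forall_of_atBot
  refine absurd (csInf_le (s := {x : ℝ | q ≤ cdf (gaussianReal 0 1) x}) ⟨y, fun z hz => ?_⟩ h)
    (not_le.2 hx)
  by_contra! hzy
  exact absurd (hy z hzy.le) (not_lt.2 hz)

theorem lt_cdf_stdNormal_of_quantile_lt {q x : ℝ} (hq : q < 1)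
    (hx : stdNormalQuantile q < x) : q < cdf (gaussianReal 0 1) x := by
  obtain ⟨y, hy⟩ := ((tendsto_cdf_atTop (gaussianReal 0 1)).eventually_const_lt hq).exists
  obtain ⟨z, hz, hzx⟩ := exists_lt_of_csInf_lt (s := {x : ℝ | q ≤ cdf (gaussianReal 0 1) x})
    ⟨y, hy.le⟩ hx
  exact lt_of_le_of_lt hz (cdf_stdNormal_lt hzx)

/-- By symmetry the disjoint tails below `x` and above `-x` have equal mass. -/
theorem cdf_stdNormal_le_half_of_neg {x : ℝ} (hx : x < 0) :
    cdf (gaussianReal 0 1) x ≤ 1 / 2 := by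
  have h := stdNormal_real_Ici_neg x
  have h1 : (gaussianReal 0 1).real (Set.Iic x ∪ Set.Ici (-x)) ≤ 1 := measureReal_le_one
  rw [measureReal_union _ measurableSet_Ici, ← cdf_eq_real, h] at h1
  · linarith
  · rw [Set.disjoint_left]
    intro y hy hy'
    simp only [Set.mem_Iic, Set.mem_Ici] at hy hy'
    linarith

theorem stdNormalQuantile_nonneg {q : ℝ} (hq : 1 / 2 < q) : 0 ≤ stdNormalQuantile q := by
  refine Real.sInf_nonneg fun x hx => ?_
  by_contra! h
  exact absurd (hq.trans_le hx) (not_lt.2 (cdf_stdNormal_le_half_of_neg h))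

/-- Chernoff's bound with the optimal parameter `x`: `exp (-x²) * exp (x² / 2)`. -/
theorem stdNormal_real_Ici_le_exp {x : ℝ} (hx : 0 ≤ x) :
    (gaussianReal 0 1).real (Set.Ici x) ≤ Real.exp (-x ^ 2 / 2) := by
  have h := measure_ge_le_exp_mul_mgf (μ := gaussianReal 0 1) (X := id) x hx
    (integrable_exp_mul_gaussianReal x)
  rw [mgf_id_gaussianReal, ← Real.exp_add] at h
  refine h.trans_eq ?_
  simp
  ring

theorem stdNormalQuantile_le_sqrt_log {α : ℝ} (hα0 : 0 < α) (hα1 : α < 1) :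
    stdNormalQuantile (1 - α) ≤ √(2 * Real.log (1 / α)) := by
  have hlog : 0 ≤ 2 * Real.log (1 / α) := by
    have := Real.log_nonneg (one_le_one_div hα0 hα1.le)
    linarith
  set x := √(2 * Real.log (1 / α)) with hx
  by_contra! h
  have h1 := cdf_stdNormal_lt_of_lt_quantile (by linarith) h
  have h2 := stdNormal_real_Ici_le_exp (Real.sqrt_nonneg _ : 0 ≤ x)
  have h3 : Real.exp (-x ^ 2 / 2) = α := by
    rw [hx, Real.sq_sqrt hlog, one_div, Real.log_inv, ← Real.exp_log hα0]
    simp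
  have h4 : (1 : ℝ) ≤ (gaussianReal 0 1).real (Set.Iic x) + (gaussianReal 0 1).real (Set.Ici x) := by
    rw [← probReal_univ (μ := gaussianReal 0 1), ← Set.Iic_union_Ici (a := x)]
    exact measureReal_union_le _ _
  rw [← cdf_eq_real] at h4
  linarith

/-- The centred normal distribution with standard deviation `τ` gives mass more than `1 - α` to the
half-line above any point smaller than `-τ Φ⁻¹(1 - α)`. -/
theorem lt_stdNormal_real_of_pos {α τ ε : ℝ} (hα0 : 0 < α) (hτ : 0 ≤ τ) (hε : 0 < ε) :
    1 - α < (gaussianReal 0 1).real {x | -stdNormalQuantile (1 - α) * τ - ε < τ * x} := by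
  rcases hτ.eq_or_lt with rfl | hτ
  · simp [hε, hα0]
  · set z := stdNormalQuantile (1 - α)
    have h := lt_cdf_stdNormal_of_quantile_lt (q := 1 - α) (by linarith)
      (show z < z + ε / (2 * τ) by have : 0 < ε / (2 * τ) := by positivity
                                   linarith)
    rw [← stdNormal_real_Ici_neg] at h
    refine h.trans_le (measureReal_mono fun x hx => ?_)
    have h1 : τ * (-(z + ε / (2 * τ))) ≤ τ * x := mul_le_mul_of_nonneg_left hx hτ.le
    have h2 : τ * (-(z + ε / (2 * τ))) = -z * τ - ε / 2 := by field_simp; ring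
    simp only [Set.mem_ofPred_eq]
    linarith

/-- Counterpart from above. Shifting by `ε` keeps both inequalities strict even for `τ = 0`, so a
singular covariance needs no separate treatment later. -/
theorem stdNormal_real_lt_of_pos {α τ ε : ℝ} (hα1 : α < 1) (hτ : 0 ≤ τ) (hε : 0 < ε) :
    (gaussianReal 0 1).real {x | -stdNormalQuantile (1 - α) * τ + ε ≤ τ * x} < 1 - α := by
  rcases hτ.eq_or_lt with rfl | hτ
  · simp [not_le.2 hε, hα1]
  · set z := stdNormalQuantile (1 - α)
    have h := cdf_stdNormal_lt_of_lt_quantile (q := 1 - α) (by linarith)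
      (show z - ε / τ < z by have : 0 < ε / τ := by positivity
                             linarith)
    rw [← stdNormal_real_Ici_neg] at h
    refine lt_of_le_of_lt (measureReal_mono fun x hx => ?_) h
    have h2 : τ * (-(z - ε / τ)) = -z * τ + ε := by field_simp; ring
    exact le_of_mul_le_mul_left (h2.trans_le hx) hτ

end Quantile

/-! ### Limits of fixed points and of perturbed maxima -/

/-- From `u = G u` one gets `(1 - K) dist u x ≤ dist (G x) x`; hence convergence at the single point
`x` suffices. -/
theorem tendsto_fixedPoint {ι X : Type*} [MetricSpace X] {l : Filter ι} {K : ℝ} (hK : K < 1)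
    {G : ι → X → X} (hG : ∀ᶠ i in l, ∀ x y, dist (G i x) (G i y) ≤ K * dist x y) {u : ι → X}
    (hu : ∀ᶠ i in l, G i (u i) = u i) {x : X} (hx : Tendsto (fun i => G i x) l (𝓝 x)) :
    Tendsto u l (𝓝 x) := by
  rw [tendsto_iff_dist_tendsto_zero] at hx ⊢
  have h := hx.const_mul (1 - K)⁻¹
  rw [mul_zero] at h
  refine tendsto_of_tendsto_of_tendsto_of_le_of_le' tendsto_const_nhds h
    (Eventually.of_forall fun _ => dist_nonneg) ?_
  filter_upwards [hG, hu] with i hGi hui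
  have h1 := dist_triangle (G i (u i)) (G i x) x
  have h2 := hGi (u i) x
  rw [hui] at h1
  rw [inv_mul_eq_div, le_div_iff₀ (by linarith)]
  rw [hui] at h2
  linarith

/-- A contraction of a nonempty complete metric space has exactly one fixed point. -/
theorem exists_unique_fixedPoint {X : Type*} [MetricSpace X] [CompleteSpace X] [Nonempty X]
    {K : ℝ} (hK0 : 0 ≤ K) (hK : K < 1) {G : X → X}
    (hG : ∀ x y, dist (G x) (G y) ≤ K * dist x y) : ∃ u, ∀ x, G x = x ↔ x = u := by
  have hc : ContractingWith ⟨K, hK0⟩ G := ⟨hK, LipschitzWith.of_dist_le_mul hG⟩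
  refine ⟨hc.fixedPoint G, fun x => ⟨fun h => hc.fixedPoint_unique h, ?_⟩⟩
  rintro rfl
  exact hc.fixedPoint_isFixedPt

/-- If the penalty `d ≤ 0` vanishes somewhere on the compact space `K`, then the maxima of
`√N d + h_N` converge to the supremum of `lim h_N` over the zero set of `d`. -/
theorem tendsto_iSup_sqrt_mul_add {K : Type*} [TopologicalSpace K] [CompactSpace K] {d : K → ℝ}
    (hd : Continuous d) (hd0 : ∀ x, d x ≤ 0) (hdz : ∃ x, d x = 0) {h : ℕ → K → ℝ} {h' : K → ℝ}
    (hh : ∀ x, Tendsto (fun p : ℕ × K => h p.1 p.2) (atTop ×ˢ 𝓝 x) (𝓝 (h' x)))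
    (hbdd : ∀ N : ℕ, BddAbove (Set.range fun x => √(N : ℝ) * d x + h N x))
    (hbdd' : BddAbove (Set.image h' {x | d x = 0})) :
    Tendsto (fun N : ℕ => ⨆ x, (√(N : ℝ) * d x + h N x)) atTop
      (𝓝 (sSup (Set.image h' {x | d x = 0}))) := by
  obtain ⟨x₀, hx₀⟩ := hdz
  have : Nonempty K := ⟨x₀⟩
  have hsqrt : Tendsto (fun N : ℕ => √(N : ℝ)) atTop atTop :=
    Real.tendsto_sqrt_atTop.comp tendsto_natCast_atTop_atTop
  refine tendsto_order.2 ⟨fun a ha => ?_, fun b hb => ?_⟩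
  -- Lower bound: test with one zero of `d` at which `h'` nearly attains the supremum.
  · obtain ⟨_, ⟨x, hx, rfl⟩, hax⟩ := exists_lt_of_lt_csSup (Set.Nonempty.image h' ⟨x₀, hx₀⟩) ha
    have hpt : Tendsto (fun N => h N x) atTop (𝓝 (h' x)) :=
      (hh x).comp (tendsto_id.prodMk tendsto_const_nhds)
    filter_upwards [hpt.eventually_const_lt hax] with N hN
    refine hN.trans_le ((le_of_eq ?_).trans (le_ciSup (hbdd N) x))
    simp [show d x = 0 from hx]
  · obtain ⟨c, hc, hcb⟩ := exists_between hb
    -- Upper bound near each `x`: where `d x = 0` the penalty is dropped; where `d x < 0` it drives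
    -- the sum to `-∞`. Compactness then makes the bound uniform.
    have key : ∀ x ∈ (Set.univ : Set K),
        {p : ℕ × K | √(p.1 : ℝ) * d p.2 + h p.1 p.2 < c} ∈ (atTop : Filter ℕ) ×ˢ 𝓝 x := by
      intro x _
      rcases (hd0 x).eq_or_lt with hx | hx
      · have : h' x < c := (le_csSup hbdd' ⟨x, hx, rfl⟩).trans_lt hc
        filter_upwards [(hh x).eventually_lt_const this] with p hp
        have := mul_nonpos_of_nonneg_of_nonpos (Real.sqrt_nonneg (p.1 : ℝ)) (hd0 p.2)
        change √(p.1 : ℝ) * d p.2 + h p.1 p.2 < c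
        linarith
      · have hdx : Tendsto (fun p : ℕ × K => d p.2) (atTop ×ˢ 𝓝 x) (𝓝 (d x)) :=
          (hd.tendsto x).comp tendsto_snd
        have hsq : Tendsto (fun p : ℕ × K => √(p.1 : ℝ)) (atTop ×ˢ 𝓝 x) atTop :=
          hsqrt.comp tendsto_fst
        exact ((hsq.atTop_mul_neg hx hdx).atBot_add (hh x)).eventually (eventually_lt_atBot c)
    have := isCompact_univ.mem_prod_nhdsSet_of_forall key
    rw [nhdsSet_univ] at this
    rw [← principal_univ] at this
    have hev : ∀ᶠ N : ℕ in atTop, ∀ x ∈ (Set.univ : Set K), √(N : ℝ) * d x + h N x < c :=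
      eventually_prod_principal_iff.1 this
    filter_upwards [hev] with N hN
    exact (ciSup_le fun x => (hN x trivial).le).trans_lt hcb

/-! ### Asymptotics of the value at risk -/

section Portmanteau

variable {ι E Ω' : Type*} {Ω : ι → Type*} {m : ∀ i, MeasurableSpace (Ω i)}
  {μ : (i : ι) → Measure (Ω i)} [∀ i, IsProbabilityMeasure (μ i)]
  {m' : MeasurableSpace Ω'} {μ' : Measure Ω'} [IsProbabilityMeasure μ']
  {mE : MeasurableSpace E} [TopologicalSpace E] [OpensMeasurableSpace E] [HasOuterApproxClosed E]
  {X : (i : ι) → Ω i → E} {Z : Ω' → E} {l : Filter ι}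

theorem MeasureTheory.TendstoInDistribution.eventually_measureReal_closed_lt
    (h : TendstoInDistribution X l Z μ μ') {F : Set E} (hF : IsClosed F) {r : ℝ}
    (hr : μ'.real (Z ⁻¹' F) < r) : ∀ᶠ i in l, (μ i).real (X i ⁻¹' F) < r := by
  have h1 := ProbabilityMeasure.limsup_measure_closed_le_of_tendsto h.tendsto hF
  have h2 : (μ'.map Z) F < ENNReal.ofReal r := by
    rw [Measure.map_apply_of_aemeasurable h.aemeasurable_limit hF.measurableSet]
    exact (ENNReal.lt_ofReal_iff_toReal_lt (measure_ne_top _ _)).2 hr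
  filter_upwards [eventually_lt_of_limsup_lt (h1.trans_lt h2)] with i hi
  simp only [ProbabilityMeasure.coe_mk] at hi
  rw [Measure.map_apply_of_aemeasurable (h.forall_aemeasurable i) hF.measurableSet] at hi
  exact (ENNReal.lt_ofReal_iff_toReal_lt (measure_ne_top _ _)).1 hi

theorem MeasureTheory.TendstoInDistribution.eventually_lt_measureReal_open
    (h : TendstoInDistribution X l Z μ μ') {G : Set E} (hG : IsOpen G) {r : ℝ} (hr0 : 0 ≤ r)
    (hr : r < μ'.real (Z ⁻¹' G)) : ∀ᶠ i in l, r < (μ i).real (X i ⁻¹' G) := by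
  have h1 := ProbabilityMeasure.le_liminf_measure_open_of_tendsto h.tendsto hG
  have h2 : ENNReal.ofReal r < (μ'.map Z) G := by
    rw [Measure.map_apply_of_aemeasurable h.aemeasurable_limit hG.measurableSet]
    exact (ENNReal.ofReal_lt_iff_lt_toReal hr0 (measure_ne_top _ _)).2 hr
  filter_upwards [eventually_lt_of_lt_liminf (h2.trans_le h1)] with i hi
  simp only [ProbabilityMeasure.coe_mk] at hi
  rw [Measure.map_apply_of_aemeasurable (h.forall_aemeasurable i) hG.measurableSet] at hi
  exact (ENNReal.ofReal_lt_iff_lt_toReal hr0 (measure_ne_top _ _)).1 hi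

end Portmanteau

/-- The law of a linear functional of a centred Gaussian vector. -/
theorem multivariateGaussian_map_inner {ι : Type*} [Fintype ι] [DecidableEq ι]
    {C : Matrix ι ι ℝ} (hC : C.PosSemidef) (c : EuclideanSpace ℝ ι) :
    (multivariateGaussian 0 C).map (fun z => inner ℝ c z) =
      (gaussianReal 0 1).map (fun x => √(c.ofLp ⬝ᵥ C *ᵥ c.ofLp) * x) := by
  have hnn : 0 ≤ c.ofLp ⬝ᵥ C *ᵥ c.ofLp := by simpa using hC.dotProduct_mulVec_nonneg c.ofLp
  have h := IsGaussian.map_eq_gaussianReal (μ := multivariateGaussian 0 C) (innerSL ℝ c)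
  have hint : (multivariateGaussian 0 C)[innerSL ℝ c] = 0 := by
    rw [ContinuousLinearMap.integral_comp_id_comm IsGaussian.integrable_id]
    simp
  have hvar : Var[innerSL ℝ c; multivariateGaussian 0 C] = c.ofLp ⬝ᵥ C *ᵥ c.ofLp := by
    rw [← covarianceBilin_multivariateGaussian (μ := 0) hC,
      covarianceBilin_self IsGaussian.memLp_two_id]
    rfl
  rw [hint, hvar] at h
  rw [gaussianReal_map_const_mul]
  convert! h using 2
  · simp
  · ext
    simp [Real.sq_sqrt hnn, hnn]

section

variable {S A : ℕ} {Pstar : Transition S A} {post : ℕ → Measure (Transition S A)}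
  [∀ N, IsProbabilityMeasure (post N)]
  {C : Matrix (Fin S × Fin A × Fin S) (Fin S × Fin A × Fin S) ℝ}

theorem norm_scaledDeviation_ge (N : ℕ) (P : Transition S A) (s : Fin S) (a : Fin A) (s' : Fin S) :
    √(N : ℝ) * |P s a s' - Pstar s a s'| ≤ ‖scaledDeviation Pstar N P‖ := by
  have h := PiLp.norm_apply_le (scaledDeviation Pstar N P) (s, a, s')
  simpa [scaledDeviation, abs_mul, abs_of_nonneg (Real.sqrt_nonneg (N : ℝ))] using h

/-- Transition functions with a bounded scaled deviation from `Pstar` are close to `Pstar`. -/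
theorem eventually_forall_norm_scaledDeviation_lt {ι : Type*} {l : Filter ι} {N : ι → ℕ}
    (hN : Tendsto N l atTop) (M : ℝ) {p : ι × Transition S A → Prop}
    (hp : ∀ᶠ x in l ×ˢ 𝓝 Pstar, p x) :
    ∀ᶠ i in l, ∀ P, ‖scaledDeviation Pstar (N i) P‖ < M → p (i, P) := by
  obtain ⟨pa, ha, pb, hb, hab⟩ := eventually_prod_iff.1 hp
  obtain ⟨ε, hε, hball⟩ := Metric.eventually_nhds_iff.1 hb
  have hsqrt : Tendsto (fun i => √(N i : ℝ)) l atTop :=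
    Real.tendsto_sqrt_atTop.comp (tendsto_natCast_atTop_atTop.comp hN)
  filter_upwards [ha, hsqrt.eventually_gt_atTop (M / ε), hsqrt.eventually_gt_atTop 0]
    with i hi hi1 hi0 P hP
  refine hab hi (hball ?_)
  have hd : ∀ s a s', dist (P s a s') (Pstar s a s') < ε := by
    intro s a s'
    have := (norm_scaledDeviation_ge (N i) P s a s').trans_lt hP
    rw [div_lt_iff₀ hε] at hi1
    rw [Real.dist_eq]
    exact lt_of_mul_lt_mul_left (this.trans hi1) hi0.le
  rw [dist_pi_lt_iff hε]
  intro s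
  rw [dist_pi_lt_iff hε]
  intro a
  rw [Subtype.dist_eq, dist_pi_lt_iff hε]
  exact hd s a

/-- The scaled deviations of an asymptotically normal sequence are tight. -/
theorem exists_eventually_measureReal_norm_ge_lt
    (hnormal : TendstoInDistribution (fun N => scaledDeviation Pstar N) atTop
      (id : EuclideanSpace ℝ (Fin S × Fin A × Fin S) → _) post (multivariateGaussian 0 C))
    {η : ℝ} (hη : 0 < η) :
    ∃ M : ℝ, 0 < M ∧
      ∀ᶠ N in atTop, (post N).real {P | M ≤ ‖scaledDeviation Pstar N P‖} < η := by
  have ht : Tendsto (fun n : ℕ => (multivariateGaussian 0 C).real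
      {z : EuclideanSpace ℝ (Fin S × Fin A × Fin S) | (n : ℝ) ≤ ‖z‖}) atTop (𝓝 0) := by
    have h0 : (⋂ n : ℕ, {z : EuclideanSpace ℝ (Fin S × Fin A × Fin S) | (n : ℝ) ≤ ‖z‖}) = ∅ := by
      ext z
      obtain ⟨n, hn⟩ := exists_nat_gt ‖z‖
      simpa using ⟨n, hn⟩
    have := tendsto_measure_iInter_atTop (μ := multivariateGaussian 0 C)
      (s := fun n : ℕ => {z : EuclideanSpace ℝ (Fin S × Fin A × Fin S) | (n : ℝ) ≤ ‖z‖})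
      (fun n => (measurableSet_le measurable_const measurable_norm).nullMeasurableSet)
      (fun n m hnm z (hz : (m : ℝ) ≤ ‖z‖) =>
        show (n : ℝ) ≤ ‖z‖ from (Nat.cast_le.2 hnm).trans hz) ⟨0, measure_ne_top _ _⟩
    rw [h0, measure_empty] at this
    exact (ENNReal.tendsto_toReal ENNReal.zero_ne_top).comp this
  obtain ⟨n, hn, hn0⟩ := ((ht.eventually_lt_const hη).and (eventually_gt_atTop 0)).exists
  exact ⟨n, Nat.cast_pos.2 hn0, hnormal.eventually_measureReal_closed_lt
    (F := {z | (n : ℝ) ≤ ‖z‖}) (isClosed_le continuous_const continuous_norm) hn⟩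

/-- **Asymptotics of the value at risk** of functions that are asymptotically linear in the scaled
deviation. -/
theorem tendsto_sqrt_mul_valueAtRisk_sub (hC : C.PosSemidef)
    (hnormal : TendstoInDistribution (fun N => scaledDeviation Pstar N) atTop
      (id : EuclideanSpace ℝ (Fin S × Fin A × Fin S) → _) post (multivariateGaussian 0 C))
    {ι : Type*} {l : Filter ι} {N : ι → ℕ} (hN : Tendsto N l atTop) {α : ℝ} (hα0 : 0 < α)
    (hα1 : α < 1) {X : ι → Transition S A → ℝ} {b : ι → ℝ}
    {c : ι → Transition S A → EuclideanSpace ℝ (Fin S × Fin A × Fin S)}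
    {c₀ : EuclideanSpace ℝ (Fin S × Fin A × Fin S)}
    (hc : Tendsto (fun x : ι × Transition S A => c x.1 x.2) (l ×ˢ 𝓝 Pstar) (𝓝 c₀))
    (hX : ∀ i P, √(N i : ℝ) * (X i P - b i) =
      inner ℝ (c i P) (scaledDeviation Pstar (N i) P)) :
    Tendsto (fun i => √(N i : ℝ) * (valueAtRisk (post (N i)) α (X i) - b i)) l
      (𝓝 (-stdNormalQuantile (1 - α) * √(c₀.ofLp ⬝ᵥ C *ᵥ c₀.ofLp))) := by
  set τ := √(c₀.ofLp ⬝ᵥ C *ᵥ c₀.ofLp) with hτ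
  have hτ0 : 0 ≤ τ := Real.sqrt_nonneg _
  set q := -stdNormalQuantile (1 - α) * τ with hq
  have hlaw : ∀ s : Set ℝ, MeasurableSet s →
      (multivariateGaussian 0 C).real ((fun z => inner ℝ c₀ z) ⁻¹' s) =
        (gaussianReal 0 1).real ((fun x => τ * x) ⁻¹' s) := by
    intro s hs
    rw [← map_measureReal_apply (by fun_prop) hs, multivariateGaussian_map_inner hC,
      map_measureReal_apply (by fun_prop) hs]
  have hsqrt : ∀ᶠ i in l, 0 < √(N i : ℝ) :=
    (Real.tendsto_sqrt_atTop.comp (tendsto_natCast_atTop_atTop.comp hN)).eventually_gt_atTop 0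
  rw [Metric.tendsto_nhds]
  intro ε hε
  -- One `ε'` is spent on the Gaussian half-line and one on replacing the slope by `c₀`; together
  -- they make `ε / 2`.
  set ε' := ε / 2 / 2 with hε'
  have hε'0 : 0 < ε' := by positivity
  have hlow := lt_stdNormal_real_of_pos (α := α) hα0 hτ0 hε'0
  have hupp := stdNormal_real_lt_of_pos (α := α) hα1 hτ0 hε'0
  rw [← hq] at hlow hupp
  obtain ⟨r₁, hr₁, hr₁'⟩ := exists_between hlow
  obtain ⟨r₂, hr₂, hr₂'⟩ := exists_between hupp
  -- The probability margins around `1 - α`; they absorb the event that the deviation has norm at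
  -- least `M`.
  set η := min (r₁ - (1 - α)) ((1 - α) - r₂)
  have hη : 0 < η := lt_min (by linarith) (by linarith)
  have e₁ := hN.eventually <| hnormal.eventually_lt_measureReal_open
    (G := (fun z => inner ℝ c₀ z) ⁻¹' Set.Ioi (q - ε')) (r := r₁)
    (isOpen_Ioi.preimage (by fun_prop)) (by linarith)
    (by rw [Set.preimage_id, hlaw _ measurableSet_Ioi]; exact hr₁')
  have e₂ := hN.eventually <| hnormal.eventually_measureReal_closed_lt
    (F := (fun z => inner ℝ c₀ z) ⁻¹' Set.Ici (q + ε')) (r := r₂)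
    (isClosed_Ici.preimage (by fun_prop))
    (by rw [Set.preimage_id, hlaw _ measurableSet_Ici]; exact hr₂)
  obtain ⟨M, hM, hMη⟩ := exists_eventually_measureReal_norm_ge_lt hnormal hη
  -- On deviations of norm below `M` the slope is within `ε' / M` of `c₀`, so Cauchy–Schwarz bounds
  -- the error by `ε'`.
  have e₃ := eventually_forall_norm_scaledDeviation_lt hN M
    ((Metric.tendsto_nhds.1 hc) (ε' / M) (by positivity))
  filter_upwards [e₁, e₂, hN.eventually hMη, e₃, hsqrt] with i h₁ h₂ h₃ h₄ h₅
  have hclose : ∀ P, ‖scaledDeviation Pstar (N i) P‖ < M →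
      |√(N i : ℝ) * (X i P - b i) - inner ℝ c₀ (scaledDeviation Pstar (N i) P)| ≤ ε' := by
    intro P hP
    rw [hX, ← inner_sub_left]
    refine (abs_real_inner_le_norm _ _).trans ?_
    have h := h₄ P hP
    rw [dist_eq_norm] at h
    calc ‖c i P - c₀‖ * ‖scaledDeviation Pstar (N i) P‖ ≤ ε' / M * M := by gcongr
      _ = ε' := by field_simp
  have hiff : ∀ t P, b i + t / √(N i : ℝ) ≤ X i P ↔ t ≤ √(N i : ℝ) * (X i P - b i) := by
    intro t P
    rw [← le_sub_iff_add_le', div_le_iff₀' h₅]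
  have hmem := valueAtRisk_mem_Icc (μ := post (N i)) (α := α) (X := X i)
    (a := b i + (q - ε / 2) / √(N i : ℝ)) (b := b i + (q + ε / 2) / √(N i : ℝ)) ?_ ?_
  · have ha : q - ε / 2 ≤ √(N i : ℝ) * (valueAtRisk (post (N i)) α (X i) - b i) := by
      rw [← div_le_iff₀' h₅]
      linarith [hmem.1]
    have hb : √(N i : ℝ) * (valueAtRisk (post (N i)) α (X i) - b i) ≤ q + ε / 2 := by
      rw [← le_div_iff₀' h₅]
      linarith [hmem.2]
    rw [Real.dist_eq, abs_lt]
    constructor <;> linarith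
  · have hsub : scaledDeviation Pstar (N i) ⁻¹' ((fun z => inner ℝ c₀ z) ⁻¹' Set.Ioi (q - ε')) ⊆
        {P | b i + (q - ε / 2) / √(N i : ℝ) ≤ X i P} ∪
          {P | M ≤ ‖scaledDeviation Pstar (N i) P‖} := by
      intro P hP
      by_cases hMP : M ≤ ‖scaledDeviation Pstar (N i) P‖
      · exact Or.inr hMP
      · left
        have h := abs_le.1 (hclose P (not_le.1 hMP))
        have hP' : q - ε' < inner ℝ c₀ (scaledDeviation Pstar (N i) P) := hP
        refine (hiff _ P).2 ?_
        linarith [h.1]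
    have h := (measureReal_mono hsub).trans (measureReal_union_le (μ := post (N i)) _ _)
    have := min_le_left (r₁ - (1 - α)) ((1 - α) - r₂)
    linarith
  · have hsub : {P | b i + (q + ε / 2) / √(N i : ℝ) ≤ X i P} ⊆
        scaledDeviation Pstar (N i) ⁻¹' ((fun z => inner ℝ c₀ z) ⁻¹' Set.Ici (q + ε')) ∪
          {P | M ≤ ‖scaledDeviation Pstar (N i) P‖} := by
      intro P hP
      by_cases hMP : M ≤ ‖scaledDeviation Pstar (N i) P‖
      · exact Or.inr hMP
      · left
        have h := abs_le.1 (hclose P (not_le.1 hMP))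
        have hP' := (hiff _ P).1 hP
        change q + ε' ≤ inner ℝ c₀ (scaledDeviation Pstar (N i) P)
        linarith [h.2]
    have h := (measureReal_mono hsub).trans (measureReal_union_le (μ := post (N i)) _ _)
    have := min_le_right (r₁ - (1 - α)) ((1 - α) - r₂)
    linarith

end

/-! ### Policy evaluation -/

theorem simplex_dotProduct_le {n : ℕ} (p : stdSimplex ℝ (Fin n)) {x : Fin n → ℝ} {c : ℝ}
    (h : ∀ i, x i ≤ c) : (p : Fin n → ℝ) ⬝ᵥ x ≤ c := by
  calc (p : Fin n → ℝ) ⬝ᵥ x ≤ ∑ i, p i * c :=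
        Finset.sum_le_sum fun i _ => mul_le_mul_of_nonneg_left (h i) (stdSimplex.zero_le p i)
    _ = c := by rw [← Finset.sum_mul, stdSimplex.sum_eq_one, one_mul]

theorem le_simplex_dotProduct {n : ℕ} (p : stdSimplex ℝ (Fin n)) {x : Fin n → ℝ} {c : ℝ}
    (h : ∀ i, c ≤ x i) : c ≤ (p : Fin n → ℝ) ⬝ᵥ x := by
  have := simplex_dotProduct_le p (x := -x) (c := -c) fun i => neg_le_neg (h i)
  rw [dotProduct_neg] at this
  linarith

theorem abs_simplex_dotProduct_le {n : ℕ} (p : stdSimplex ℝ (Fin n)) (x : Fin n → ℝ) :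
    |(p : Fin n → ℝ) ⬝ᵥ x| ≤ ‖x‖ :=
  abs_le.2 ⟨le_simplex_dotProduct p fun i => (abs_le.1 (norm_le_pi_norm x i)).1,
    simplex_dotProduct_le p fun i => (abs_le.1 (norm_le_pi_norm x i)).2⟩

theorem integral_simplexMeasure {n : ℕ} (p : stdSimplex ℝ (Fin n)) (f : Fin n → ℝ) :
    ∫ i, f i ∂(simplexMeasure p) = (p : Fin n → ℝ) ⬝ᵥ f := by
  rw [simplexMeasure, integral_finsetSum_measure]
  · simp [dotProduct]
  · intro i _
    exact Integrable.smul_measure (by simp) ENNReal.ofReal_ne_top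

noncomputable section

section

variable {S A : ℕ}

/-- The transition matrix of the state process under the policy `π`. -/
def policyMatrix (π : Policy S A) (P : Transition S A) : Matrix (Fin S) (Fin S) ℝ :=
  Matrix.of fun s s' => ∑ a, π s a * P s a s'

/-- The expected one-step reward under the policy `π`. -/
def policyReward (R : Fin S → Fin A → Fin S → ℝ) (π : Policy S A) (P : Transition S A) :
    Fin S → ℝ :=
  fun s => ∑ a, π s a * ∑ s', P s a s' * R s a s'

/-- The value function of the policy `π`. -/
def policyValue (R : Fin S → Fin A → Fin S → ℝ) (γ : ℝ) (π : Policy S A) (P : Transition S A) :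
    Fin S → ℝ :=
  (1 - γ • policyMatrix π P)⁻¹ *ᵥ policyReward R π P

theorem policyMatrix_mulVec (π : Policy S A) (P : Transition S A) (x : Fin S → ℝ) (s : Fin S) :
    (policyMatrix π P *ᵥ x) s = (π s : Fin A → ℝ) ⬝ᵥ fun a => (P s a : Fin S → ℝ) ⬝ᵥ x := by
  simp only [policyMatrix, Matrix.mulVec, dotProduct, Matrix.of_apply, Finset.sum_mul,
    Finset.mul_sum, mul_assoc]
  exact Finset.sum_comm

theorem norm_policyMatrix_mulVec_le (π : Policy S A) (P : Transition S A) (x : Fin S → ℝ) :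
    ‖policyMatrix π P *ᵥ x‖ ≤ ‖x‖ := by
  refine (pi_norm_le_iff_of_nonneg (norm_nonneg _)).2 fun s => ?_
  rw [policyMatrix_mulVec]
  exact (abs_simplex_dotProduct_le _ _).trans
    ((pi_norm_le_iff_of_nonneg (norm_nonneg _)).2 fun a => abs_simplex_dotProduct_le _ _)

theorem policyReward_add_smul_mulVec (R : Fin S → Fin A → Fin S → ℝ) (γ : ℝ) (π : Policy S A)
    (P : Transition S A) (v : Fin S → ℝ) (s : Fin S) :
    (policyReward R π P + γ • (policyMatrix π P *ᵥ v)) s =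
      (π s : Fin A → ℝ) ⬝ᵥ fun a => (P s a : Fin S → ℝ) ⬝ᵥ oneStepValue R γ v s a := by
  simp only [Pi.add_apply, Pi.smul_apply, policyMatrix_mulVec, policyReward, oneStepValue,
    dotProduct_add, dotProduct_smul, smul_eq_mul]
  simp only [dotProduct, mul_add, Finset.sum_add_distrib, Finset.mul_sum]
  simp only [mul_left_comm]

/-- A kernel vector satisfies `x = γ P_π x`, and a stochastic matrix does not increase the sup norm,
so `‖x‖ ≤ γ ‖x‖`. -/
theorem isUnit_det_one_sub_smul_policyMatrix {γ : ℝ} (hγ0 : 0 ≤ γ) (hγ1 : γ < 1)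
    (π : Policy S A) (P : Transition S A) : IsUnit (1 - γ • policyMatrix π P).det := by
  rw [isUnit_iff_ne_zero]
  intro h
  obtain ⟨x, hx, hx0⟩ := Matrix.exists_mulVec_eq_zero_iff.2 h
  rw [Matrix.sub_mulVec, Matrix.one_mulVec, Matrix.smul_mulVec, sub_eq_zero] at hx0
  have h1 : ‖x‖ = γ * ‖policyMatrix π P *ᵥ x‖ := by
    conv_lhs => rw [hx0]
    rw [norm_smul, Real.norm_of_nonneg hγ0]
  have h2 := mul_le_mul_of_nonneg_left (norm_policyMatrix_mulVec_le π P x) hγ0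
  have h3 : 0 < ‖x‖ := norm_pos_iff.2 hx
  nlinarith

theorem one_sub_smul_policyMatrix_mulVec_policyValue (R : Fin S → Fin A → Fin S → ℝ) {γ : ℝ}
    (hγ0 : 0 ≤ γ) (hγ1 : γ < 1) (π : Policy S A) (P : Transition S A) :
    (1 - γ • policyMatrix π P) *ᵥ policyValue R γ π P = policyReward R π P := by
  rw [policyValue, Matrix.mulVec_mulVec,
    Matrix.mul_nonsing_inv _ (isUnit_det_one_sub_smul_policyMatrix hγ0 hγ1 π P),
    Matrix.one_mulVec]

/-- The value function is a fixed point of the policy Bellman operator. -/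
theorem policyValue_apply (R : Fin S → Fin A → Fin S → ℝ) {γ : ℝ}
    (hγ0 : 0 ≤ γ) (hγ1 : γ < 1) (π : Policy S A) (P : Transition S A) (s : Fin S) :
    policyValue R γ π P s = (π s : Fin A → ℝ) ⬝ᵥ
      fun a => (P s a : Fin S → ℝ) ⬝ᵥ oneStepValue R γ (policyValue R γ π P) s a := by
  rw [← policyReward_add_smul_mulVec,
    ← one_sub_smul_policyMatrix_mulVec_policyValue R hγ0 hγ1 π P, Matrix.sub_mulVec,
    Matrix.one_mulVec, Matrix.smul_mulVec, sub_add_cancel]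

/-! ### The expected return as a value function -/

instance (p₀ : stdSimplex ℝ (Fin S)) (π : Policy S A) (P : Transition S A) :
    IsProbabilityMeasure (trajectoryLaw p₀ π P) :=
  inferInstanceAs (IsProbabilityMeasure (Kernel.trajMeasure (X := fun _ => Fin S × Fin A)
    (simplexMeasure p₀ ⊗ₘ policyKernel π) (historyKernel π P)))

theorem integral_simplexMeasure_compProd_policyKernel (p : stdSimplex ℝ (Fin S))
    (π : Policy S A) (f : Fin S × Fin A → ℝ) :
    ∫ x, f x ∂(simplexMeasure p ⊗ₘ policyKernel π) =
      (p : Fin S → ℝ) ⬝ᵥ fun s => (π s : Fin A → ℝ) ⬝ᵥ fun a => f (s, a) := by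
  rw [Measure.integral_compProd .of_finite, integral_simplexMeasure]
  congr 1
  ext s
  exact integral_simplexMeasure (π s) fun a => f (s, a)

theorem map_eval_zero_trajectoryLaw (p₀ : stdSimplex ℝ (Fin S)) (π : Policy S A)
    (P : Transition S A) :
    (trajectoryLaw p₀ π P).map (fun ω => ω 0) = simplexMeasure p₀ ⊗ₘ policyKernel π := by
  have h : (trajectoryLaw p₀ π P).map (Preorder.frestrictLe 0) =
      (simplexMeasure p₀ ⊗ₘ policyKernel π).map
        (MeasurableEquiv.piUnique (fun _ : Finset.Iic 0 => Fin S × Fin A)).symm := by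
    rw [trajectoryLaw, Kernel.trajMeasure, Measure.map_comp _ _ (by fun_prop),
      Kernel.traj_map_frestrictLe, Kernel.partialTraj_self, Measure.id_comp]
  have h2 : (fun ω : ℕ → Fin S × Fin A => ω 0) =
      (fun h : Finset.Iic 0 → Fin S × Fin A => h ⟨0, Finset.mem_Iic.2 le_rfl⟩) ∘
        Preorder.frestrictLe (π := fun _ => Fin S × Fin A) 0 := rfl
  rw [h2, ← Measure.map_map (by fun_prop) (by fun_prop), h,
    Measure.map_map (by fun_prop) (by fun_prop)]
  exact Measure.map_id

theorem integral_trajectoryLaw_eval_zero (p₀ : stdSimplex ℝ (Fin S)) (π : Policy S A)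
    (P : Transition S A) (f : Fin S × Fin A → ℝ) :
    ∫ ω, f (ω 0) ∂(trajectoryLaw p₀ π P) =
      (p₀ : Fin S → ℝ) ⬝ᵥ fun s => (π s : Fin A → ℝ) ⬝ᵥ fun a => f (s, a) := by
  rw [← integral_simplexMeasure_compProd_policyKernel, ← map_eval_zero_trajectoryLaw p₀ π P,
    integral_map (measurable_pi_apply 0).aemeasurable
      (Measurable.of_discrete).aestronglyMeasurable]

theorem integrable_trajectoryLaw (p₀ : stdSimplex ℝ (Fin S)) (π : Policy S A)
    (P : Transition S A) (f : (Fin S × Fin A) × (Fin S × Fin A) → ℝ) (t u : ℕ) :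
    Integrable (fun ω => f (ω t, ω u)) (trajectoryLaw p₀ π P) := by
  have hm : Measurable fun ω : ℕ → Fin S × Fin A => (ω t, ω u) := by fun_prop
  exact Integrable.comp_measurable (g := f) .of_finite hm

/-- The Markov property of the trajectory. -/
theorem integral_trajectoryLaw_step (p₀ : stdSimplex ℝ (Fin S)) (π : Policy S A)
    (P : Transition S A) (f : (Fin S × Fin A) × (Fin S × Fin A) → ℝ) (t : ℕ) :
    ∫ ω, f (ω t, ω (t + 1)) ∂(trajectoryLaw p₀ π P) =
      ∫ ω, ((P (ω t).1 (ω t).2 : Fin S → ℝ) ⬝ᵥ fun s => (π s : Fin A → ℝ) ⬝ᵥ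
        fun a => f (ω t, (s, a))) ∂(trajectoryLaw p₀ π P) := by
  have h := Kernel.map_frestrictLe_trajMeasure_compProd_eq_map_trajMeasure
    (X := fun _ => Fin S × Fin A) (μ₀ := simplexMeasure p₀ ⊗ₘ policyKernel π)
    (κ := historyKernel π P) (a := t)
  let g : (Finset.Iic t → Fin S × Fin A) × (Fin S × Fin A) → ℝ :=
    fun x => f (x.1 ⟨t, Finset.mem_Iic.2 le_rfl⟩, x.2)
  calc ∫ ω, f (ω t, ω (t + 1)) ∂(trajectoryLaw p₀ π P)
      = ∫ x, g x ∂((trajectoryLaw p₀ π P).map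
          fun ω => (Preorder.frestrictLe (π := fun _ => Fin S × Fin A) t ω, ω (t + 1))) := by
        rw [integral_map (by fun_prop) (Measurable.of_discrete).aestronglyMeasurable]
        rfl
    _ = ∫ x, g x ∂((trajectoryLaw p₀ π P).map
          (Preorder.frestrictLe (π := fun _ => Fin S × Fin A) t) ⊗ₘ historyKernel π P t) := by
        rw [trajectoryLaw, h]
    _ = ∫ x, ∫ y, g (x, y) ∂(historyKernel π P t x) ∂((trajectoryLaw p₀ π P).map
          (Preorder.frestrictLe (π := fun _ => Fin S × Fin A) t)) := by
        have : IsProbabilityMeasure ((trajectoryLaw p₀ π P).map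
          (Preorder.frestrictLe (π := fun _ => Fin S × Fin A) t)) :=
            Measure.isProbabilityMeasure_map (by fun_prop)
        exact Measure.integral_compProd .of_finite
    _ = ∫ ω, ∫ y, f (ω t, y) ∂(stepKernel π P (ω t)) ∂(trajectoryLaw p₀ π P) := by
        rw [integral_map (by fun_prop) (Measurable.of_discrete).aestronglyMeasurable]
        rfl
    _ = _ := by
        congr 1
        ext ω
        exact integral_simplexMeasure_compProd_policyKernel _ π fun y => f (ω t, y)

/-- The expected discounted return is the mean of the value function. -/
theorem expectedReturn_eq (R : Fin S → Fin A → Fin S → ℝ) (p₀ : stdSimplex ℝ (Fin S)) {γ : ℝ}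
    (hγ0 : 0 ≤ γ) (hγ1 : γ < 1) (π : Policy S A) (P : Transition S A) :
    expectedReturn R p₀ γ π P = (p₀ : Fin S → ℝ) ⬝ᵥ policyValue R γ π P := by
  set T := trajectoryLaw p₀ π P with hT
  set v := policyValue R γ π P with hv
  -- The action-value function. By the Markov property the mean reward at time `t` is `E q_t - γ E
  -- q_{t+1}`, so the discounted sum telescopes.
  let q : Fin S × Fin A → ℝ := fun x => (P x.1 x.2 : Fin S → ℝ) ⬝ᵥ oneStepValue R γ v x.1 x.2
  have hvq : ∀ s, v s = (π s : Fin A → ℝ) ⬝ᵥ fun a => q (s, a) :=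
    policyValue_apply R hγ0 hγ1 π P
  have hintR : ∀ t, Integrable (fun ω => R (ω t).1 (ω t).2 (ω (t + 1)).1) T := fun t =>
    integrable_trajectoryLaw p₀ π P (fun x => R x.1.1 x.1.2 x.2.1) t (t + 1)
  have hintq : ∀ t, Integrable (fun ω => q (ω t)) T := fun t =>
    integrable_trajectoryLaw p₀ π P (fun x => q x.1) t t
  have hstep : ∀ t, ∫ ω, R (ω t).1 (ω t).2 (ω (t + 1)).1 ∂T =
      ∫ ω, q (ω t) ∂T - γ * ∫ ω, q (ω (t + 1)) ∂T := by
    intro t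
    rw [eq_sub_iff_add_eq, ← integral_const_mul, ← integral_add (hintR t)
      ((hintq (t + 1)).const_mul γ)]
    rw [integral_trajectoryLaw_step p₀ π P
      (fun x => R x.1.1 x.1.2 x.2.1 + γ * q x.2) t]
    congr 1
    ext ω
    simp only [q, oneStepValue]
    congr 1
    ext s'
    have h1 : (fun a => R (ω t).1 (ω t).2 s' + γ * q (s', a)) =
        (fun _ => R (ω t).1 (ω t).2 s') + γ • fun a => q (s', a) := by
      ext a
      simp
    change (π s' : Fin A → ℝ) ⬝ᵥ (fun a => R (ω t).1 (ω t).2 s' + γ * q (s', a)) = _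
    rw [h1, dotProduct_add, dotProduct_smul, ← hvq]
    simp [dotProduct, ← Finset.sum_mul]
  obtain ⟨B, hB⟩ : ∃ B, ∀ x : (Fin S × Fin A) × Fin S, |R x.1.1 x.1.2 x.2| ≤ B := by
    obtain ⟨B, hB⟩ := (Set.finite_range
      fun x : (Fin S × Fin A) × Fin S => |R x.1.1 x.1.2 x.2|).bddAbove
    exact ⟨B, fun x => hB ⟨x, rfl⟩⟩
  have hsum : Summable fun t : ℕ =>
      ∫ ω, ‖γ ^ t * R (ω t).1 (ω t).2 (ω (t + 1)).1‖ ∂T := by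
    refine Summable.of_nonneg_of_le (fun t => integral_nonneg fun _ => norm_nonneg _)
      (fun t => ?_) ((summable_geometric_of_lt_one hγ0 hγ1).mul_right B)
    calc ∫ ω, ‖γ ^ t * R (ω t).1 (ω t).2 (ω (t + 1)).1‖ ∂T ≤ ∫ _, γ ^ t * B ∂T := by
          refine integral_mono (((hintR t).const_mul _).norm) (integrable_const _) fun ω => ?_
          simp only [norm_mul, Real.norm_eq_abs, abs_pow, abs_of_nonneg hγ0]
          exact mul_le_mul_of_nonneg_left (hB (ω t, (ω (t + 1)).1)) (pow_nonneg hγ0 t)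
      _ = γ ^ t * B := by simp
  have hs := (hasSum_integral_of_summable_integral_norm
    (fun t => (hintR t).const_mul (γ ^ t)) hsum).tendsto_sum_nat
  have hpart : ∀ n : ℕ, ∑ t ∈ Finset.range n,
      ∫ ω, γ ^ t * R (ω t).1 (ω t).2 (ω (t + 1)).1 ∂T =
        ∫ ω, q (ω 0) ∂T - γ ^ n * ∫ ω, q (ω n) ∂T := by
    intro n
    induction n with
    | zero => simp
    | succ n ih =>
      rw [Finset.sum_range_succ, ih, integral_const_mul, hstep]
      ring
  have hlim : Tendsto (fun n : ℕ => ∫ ω, q (ω 0) ∂T - γ ^ n * ∫ ω, q (ω n) ∂T) atTop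
      (𝓝 (∫ ω, q (ω 0) ∂T - 0)) := by
    refine tendsto_const_nhds.sub ?_
    refine (tendsto_pow_atTop_nhds_zero_of_lt_one hγ0 hγ1).zero_mul_isBoundedUnder_le ?_
    obtain ⟨D, hD⟩ := (Set.finite_range fun x => ‖q x‖).bddAbove
    refine isBoundedUnder_of ⟨D, fun n => ?_⟩
    refine (norm_integral_le_of_norm_le_const (C := D)
      (Eventually.of_forall fun ω : ℕ → Fin S × Fin A => hD ⟨ω n, rfl⟩)).trans_eq ?_
    simp
  simp_rw [hpart] at hs
  rw [expectedReturn, ← hT, tendsto_nhds_unique hs hlim, sub_zero,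
    integral_trajectoryLaw_eval_zero]
  congr 1
  ext s
  exact (hvq s).symm

end

end

noncomputable section

/-! ### Dependence of the return on the transition function -/

section

variable {S A : ℕ}

theorem continuous_stdSimplex_apply {n : ℕ} (i : Fin n) :
    Continuous fun p : stdSimplex ℝ (Fin n) => p i :=
  (continuous_apply i).comp continuous_subtype_val

theorem continuous_policy_apply (s : Fin S) (a : Fin A) :
    Continuous fun π : Policy S A => π s a :=
  (continuous_stdSimplex_apply a).comp (continuous_apply s)

theorem continuous_transition_apply (s : Fin S) (a : Fin A) (s' : Fin S) :
    Continuous fun P : Transition S A => P s a s' :=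
  (continuous_stdSimplex_apply s').comp (continuous_apply_apply s a)

/-- The inverse is the adjugate divided by a determinant that never vanishes. -/
theorem Continuous.one_sub_smul_policyMatrix_inv {T : Type*} [TopologicalSpace T] {γ : ℝ}
    (hγ0 : 0 ≤ γ) (hγ1 : γ < 1) {π : T → Policy S A} {P : T → Transition S A}
    (hπ : Continuous π) (hP : Continuous P) :
    Continuous fun t => (1 - γ • policyMatrix (π t) (P t))⁻¹ := by
  have hM : Continuous fun t => 1 - γ • policyMatrix (π t) (P t) := by
    refine continuous_const.sub (Continuous.const_smul ?_ γ)
    refine continuous_matrix fun s s' => ?_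
    simp only [policyMatrix, Matrix.of_apply]
    exact continuous_finsetSum _ fun a _ => ((continuous_policy_apply s a).comp hπ).mul
      ((continuous_transition_apply s a s').comp hP)
  simp only [Matrix.inv_def, Ring.inverse_eq_inv']
  exact (hM.matrix_det.inv₀ fun t =>
    (isUnit_det_one_sub_smul_policyMatrix hγ0 hγ1 (π t) (P t)).ne_zero).smul hM.matrix_adjugate

theorem continuous_policyValue (R : Fin S → Fin A → Fin S → ℝ) {γ : ℝ} (hγ0 : 0 ≤ γ)
    (hγ1 : γ < 1) :
    Continuous fun x : Policy S A × Transition S A => policyValue R γ x.1 x.2 := by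
  refine (Continuous.one_sub_smul_policyMatrix_inv hγ0 hγ1 continuous_fst continuous_snd).matrix_mulVec
    (continuous_pi fun s => ?_)
  exact continuous_finsetSum _ fun a _ => ((continuous_policy_apply s a).comp continuous_fst).mul
    (continuous_finsetSum _ fun s' _ =>
      ((continuous_transition_apply s a s').comp continuous_snd).mul continuous_const)

theorem continuous_expectedReturn (R : Fin S → Fin A → Fin S → ℝ) (p₀ : stdSimplex ℝ (Fin S))
    {γ : ℝ} (hγ0 : 0 ≤ γ) (hγ1 : γ < 1) :
    Continuous fun x : Policy S A × Transition S A => expectedReturn R p₀ γ x.1 x.2 := by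
  simp only [expectedReturn_eq R p₀ hγ0 hγ1]
  exact continuous_const.dotProduct (continuous_policyValue R hγ0 hγ1)

/-- The slope of the return of `π` between the transition functions `Pstar` and `P`. -/
def returnSlope (R : Fin S → Fin A → Fin S → ℝ) (p₀ : stdSimplex ℝ (Fin S)) (γ : ℝ)
    (Pstar : Transition S A) (π : Policy S A) (P : Transition S A) :
    EuclideanSpace ℝ (Fin S × Fin A × Fin S) :=
  WithLp.toLp 2 fun x =>
    ((p₀ : Fin S → ℝ) ᵥ* (1 - γ • policyMatrix π Pstar)⁻¹) x.1 * π x.1 x.2.1 *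
      oneStepValue R γ (policyValue R γ π P) x.1 x.2.1 x.2.2

theorem continuous_returnSlope (R : Fin S → Fin A → Fin S → ℝ) (p₀ : stdSimplex ℝ (Fin S))
    {γ : ℝ} (hγ0 : 0 ≤ γ) (hγ1 : γ < 1) (Pstar : Transition S A) :
    Continuous fun x : Policy S A × Transition S A => returnSlope R p₀ γ Pstar x.1 x.2 := by
  refine (PiLp.continuous_toLp 2 _).comp (continuous_pi fun y => ?_)
  have h1 : Continuous fun x : Policy S A × Transition S A =>
      (p₀ : Fin S → ℝ) ᵥ* (1 - γ • policyMatrix x.1 Pstar)⁻¹ :=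
    continuous_const.matrix_vecMul
      (Continuous.one_sub_smul_policyMatrix_inv hγ0 hγ1 continuous_fst continuous_const)
  have h2 : Continuous fun x : Policy S A × Transition S A =>
      oneStepValue R γ (policyValue R γ x.1 x.2) y.1 y.2.1 :=
    continuous_const.add ((continuous_policyValue R hγ0 hγ1).const_smul γ)
  exact (((continuous_apply y.1).comp h1).mul
    ((continuous_policy_apply y.1 y.2.1).comp continuous_fst)).mul
      ((continuous_apply y.2.2).comp h2)

/-- Subtracting the Bellman equations under `P` and `Pstar` gives `(1 - γ Pstar_π)(v_P - v_Pstar) =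
b`, with `b` linear in `P - Pstar` once `v_P` is kept as a coefficient. The identity is exact: the
nonlinearity sits in the slope, which is continuous in `P`. -/
theorem sqrt_mul_expectedReturn_sub (R : Fin S → Fin A → Fin S → ℝ) (p₀ : stdSimplex ℝ (Fin S))
    {γ : ℝ} (hγ0 : 0 ≤ γ) (hγ1 : γ < 1) (Pstar : Transition S A) (π : Policy S A)
    (P : Transition S A) (N : ℕ) :
    √(N : ℝ) * (expectedReturn R p₀ γ π P - expectedReturn R p₀ γ π Pstar) =
      inner ℝ (returnSlope R p₀ γ Pstar π P) (scaledDeviation Pstar N P) := by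
  set v := policyValue R γ π P with hv
  set b : Fin S → ℝ := fun s => ∑ a, π s a * ∑ s', (P s a s' - Pstar s a s') *
    oneStepValue R γ v s a s' with hb
  have hb' : (1 - γ • policyMatrix π Pstar) *ᵥ (v - policyValue R γ π Pstar) = b := by
    rw [Matrix.mulVec_sub, one_sub_smul_policyMatrix_mulVec_policyValue R hγ0 hγ1,
      Matrix.sub_mulVec, Matrix.one_mulVec, Matrix.smul_mulVec, sub_sub, add_comm]
    ext s
    rw [Pi.sub_apply, policyReward_add_smul_mulVec, hv, policyValue_apply R hγ0 hγ1 π P s, ← hv,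
      ← dotProduct_sub]
    simp only [hb, dotProduct, Pi.sub_apply, sub_mul, Finset.sum_sub_distrib]
  have hsol : v - policyValue R γ π Pstar = (1 - γ • policyMatrix π Pstar)⁻¹ *ᵥ b := by
    rw [← hb', Matrix.mulVec_mulVec,
      Matrix.nonsing_inv_mul _ (isUnit_det_one_sub_smul_policyMatrix hγ0 hγ1 π Pstar),
      Matrix.one_mulVec]
  rw [expectedReturn_eq R p₀ hγ0 hγ1, expectedReturn_eq R p₀ hγ0 hγ1, ← dotProduct_sub, ← hv,
    hsol, Matrix.dotProduct_mulVec, PiLp.inner_apply]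
  simp only [returnSlope, scaledDeviation, dotProduct, hb, Fintype.sum_prod_type, Finset.mul_sum,
    RCLike.inner_apply, conj_trivial, ← hv]
  refine Finset.sum_congr rfl fun s _ => Finset.sum_congr rfl fun a _ =>
    Finset.sum_congr rfl fun s' _ => ?_
  ring

/-! ### Optimal values -/

/-- Maximum principle: the largest excess `m` of the policy value over `v` satisfies `m ≤ γ m`. -/
theorem policyValue_le_of_bellman [NeZero S] {R : Fin S → Fin A → Fin S → ℝ} {γ : ℝ}
    (hγ0 : 0 ≤ γ) (hγ1 : γ < 1) {P : Transition S A} {v : Fin S → ℝ}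
    (hv : ∀ s a, (P s a : Fin S → ℝ) ⬝ᵥ oneStepValue R γ v s a ≤ v s) (π : Policy S A)
    (s : Fin S) : policyValue R γ π P s ≤ v s := by
  obtain ⟨s₀, hs₀⟩ := Finite.exists_max fun s => policyValue R γ π P s - v s
  set m := policyValue R γ π P s₀ - v s₀ with hm
  have hstep : policyValue R γ π P s₀ ≤ v s₀ + γ * m := by
    rw [policyValue_apply R hγ0 hγ1]
    refine simplex_dotProduct_le _ fun a => ?_
    have h1 : (P s₀ a : Fin S → ℝ) ⬝ᵥ (oneStepValue R γ (policyValue R γ π P) s₀ a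
        - oneStepValue R γ v s₀ a) ≤ γ * m := by
      refine simplex_dotProduct_le _ fun s' => ?_
      have := mul_le_mul_of_nonneg_left (hs₀ s') hγ0
      simp only [oneStepValue, Pi.sub_apply, Pi.add_apply, Pi.smul_apply, smul_eq_mul]
      linarith
    rw [dotProduct_sub] at h1
    linarith [hv s₀ a]
  have hm0 : m ≤ 0 := by nlinarith
  linarith [hs₀ s]

/-- For the deterministic greedy policy, `v` solves the evaluation equation, whose solution is
unique. -/
theorem exists_policyValue_eq {R : Fin S → Fin A → Fin S → ℝ} {γ : ℝ}
    (hγ0 : 0 ≤ γ) (hγ1 : γ < 1) {P : Transition S A} {v : Fin S → ℝ}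
    (hv : ∀ s, ∃ a, (P s a : Fin S → ℝ) ⬝ᵥ oneStepValue R γ v s a = v s) :
    ∃ π : Policy S A, policyValue R γ π P = v := by
  choose f hf using hv
  let π : Policy S A := fun s => ⟨Pi.single (f s) 1, single_mem_stdSimplex ℝ (f s)⟩
  refine ⟨π, ?_⟩
  have h : policyReward R π P = (1 - γ • policyMatrix π P) *ᵥ v := by
    rw [Matrix.sub_mulVec, Matrix.one_mulVec, Matrix.smul_mulVec, eq_sub_iff_add_eq]
    ext s
    rw [policyReward_add_smul_mulVec, ← hf s]
    exact single_one_dotProduct _ _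
  rw [policyValue, h, Matrix.mulVec_mulVec,
    Matrix.nonsing_inv_mul _ (isUnit_det_one_sub_smul_policyMatrix hγ0 hγ1 π P),
    Matrix.one_mulVec]

end

/-! ### Finite maxima -/

theorem mul_iSup_sub {ι : Type*} [Nonempty ι] {f : ι → ℝ} (hf : BddAbove (Set.range f)) {a : ℝ}
    (ha : 0 ≤ a) (b : ℝ) : a * ((⨆ i, f i) - b) = ⨆ i, a * (f i - b) := by
  rw [← Real.mul_iSup_of_nonneg ha, ciSup_sub hf]

theorem dist_iSup_le {S A : ℕ} [NeZero A] {f g : Fin S → Fin A → ℝ} {D : ℝ} (hD : 0 ≤ D)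
    (h : ∀ s a, f s a ≤ g s a + D) (h' : ∀ s a, g s a ≤ f s a + D) :
    dist (fun s => ⨆ a, f s a) (fun s => ⨆ a, g s a) ≤ D := by
  refine (dist_pi_le_iff hD).2 fun s => ?_
  have h1 : (⨆ a, f s a) ≤ (⨆ a, g s a) + D := ciSup_le fun a => (h s a).trans
    (add_le_add_left (le_ciSup (Set.finite_range _).bddAbove a) D)
  have h2 : (⨆ a, g s a) ≤ (⨆ a, f s a) + D := ciSup_le fun a => (h' s a).trans
    (add_le_add_left (le_ciSup (Set.finite_range _).bddAbove a) D)
  rw [Real.dist_eq, abs_le]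
  constructor <;> linarith

theorem simplex_dotProduct_le_add_dist {n : ℕ} (p : stdSimplex ℝ (Fin n)) (x y : Fin n → ℝ) :
    (p : Fin n → ℝ) ⬝ᵥ x ≤ (p : Fin n → ℝ) ⬝ᵥ y + dist x y := by
  have := (abs_le.1 (abs_simplex_dotProduct_le p (x - y))).2
  rw [dotProduct_sub, ← dist_eq_norm] at this
  linarith

theorem simplex_dotProduct_oneStepValue_le {S A : ℕ} (R : Fin S → Fin A → Fin S → ℝ) {γ : ℝ}
    (hγ0 : 0 ≤ γ) (p : stdSimplex ℝ (Fin S)) (s : Fin S) (a : Fin A) (v u : Fin S → ℝ) :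
    (p : Fin S → ℝ) ⬝ᵥ oneStepValue R γ v s a ≤
      (p : Fin S → ℝ) ⬝ᵥ oneStepValue R γ u s a + γ * dist v u := by
  simp only [oneStepValue, dotProduct_add, dotProduct_smul, smul_eq_mul]
  have := mul_le_mul_of_nonneg_left (simplex_dotProduct_le_add_dist p v u) hγ0
  linarith

/-- The operator `u ↦ (max_a (c_{s,a} + γ p_{s,a}ᵀ u))_s` is a `γ`-contraction. -/
theorem dist_iSup_add_mul_le {S A : ℕ} [NeZero A] (c : Fin S → Fin A → ℝ) (P : Transition S A)
    {γ : ℝ} (hγ0 : 0 ≤ γ) (u v : Fin S → ℝ) :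
    dist (fun s => ⨆ a, (c s a + γ * (P s a : Fin S → ℝ) ⬝ᵥ u))
      (fun s => ⨆ a, (c s a + γ * (P s a : Fin S → ℝ) ⬝ᵥ v)) ≤ γ * dist u v := by
  refine dist_iSup_le (by positivity) (fun s a => ?_) fun s a => ?_
  · have := mul_le_mul_of_nonneg_left (simplex_dotProduct_le_add_dist (P s a) u v) hγ0
    linarith
  · have := mul_le_mul_of_nonneg_left (simplex_dotProduct_le_add_dist (P s a) v u) hγ0
    rw [dist_comm v u] at this
    linarith

theorem tendsto_iSup_sqrt_mul_add_of_finite {K : Type*} [Finite K] {d : K → ℝ}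
    (hd0 : ∀ x, d x ≤ 0) (hdz : ∃ x, d x = 0) {h : ℕ → K → ℝ} {h' : K → ℝ}
    (hh : ∀ x, Tendsto (fun N => h N x) atTop (𝓝 (h' x))) :
    Tendsto (fun N : ℕ => ⨆ x, (√(N : ℝ) * d x + h N x)) atTop
      (𝓝 (sSup (Set.image h' {x | d x = 0}))) := by
  -- In the discrete topology a finite set is compact and joint convergence reduces to pointwise
  -- convergence.
  let _ : TopologicalSpace K := ⊥
  have : DiscreteTopology K := ⟨rfl⟩
  refine tendsto_iSup_sqrt_mul_add continuous_of_discreteTopology hd0 hdz (fun x => ?_)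
    (fun N => (Set.finite_range _).bddAbove) (Set.toFinite _).bddAbove
  rw [nhds_discrete, prod_pure, tendsto_map'_iff]
  exact hh x

/-! ### The VaR Bellman operator -/

section

variable {S A : ℕ} (R : Fin S → Fin A → Fin S → ℝ) {γ : ℝ}

/-- Changing `v` to `u` moves every random variable by at most `γ * dist v u`, hence also its VaR
and the maximum over actions. -/
theorem dist_varBellman_le [NeZero A] (hγ0 : 0 ≤ γ) (μ : Measure (Transition S A))
    [IsProbabilityMeasure μ] {α : ℝ} (hα0 : 0 ≤ α) (hα1 : α < 1) (v u : Fin S → ℝ) :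
    dist (varBellman R γ μ α v) (varBellman R γ μ α u) ≤ γ * dist v u := by
  have key : ∀ (v u : Fin S → ℝ) s a,
      valueAtRisk μ α (fun P => (P s a : Fin S → ℝ) ⬝ᵥ oneStepValue R γ v s a) ≤
        valueAtRisk μ α (fun P => (P s a : Fin S → ℝ) ⬝ᵥ oneStepValue R γ u s a) +
          γ * dist v u := fun v u s a =>
    valueAtRisk_le_add hα0 hα1
      (fun P => (abs_simplex_dotProduct_le (P s a) _).trans (le_max_left _ _))
      (fun P => (abs_simplex_dotProduct_le (P s a) _).trans (le_max_right _ _))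
      fun P => simplex_dotProduct_oneStepValue_le R hγ0 (P s a) s a v u
  exact dist_iSup_le (by positivity) (fun s a => key v u s a)
    fun s a => dist_comm v u ▸ key u v s a

/-- The vector with entries `w` in the block of `(s, a)` and zeros elsewhere. -/
def blockVector (s : Fin S) (a : Fin A) (w : Fin S → ℝ) :
    EuclideanSpace ℝ (Fin S × Fin A × Fin S) :=
  WithLp.toLp 2 fun x => if x.1 = s then if x.2.1 = a then w x.2.2 else 0 else 0

theorem continuous_blockVector (s : Fin S) (a : Fin A) : Continuous (blockVector s a) := by
  refine (PiLp.continuous_toLp 2 _).comp (continuous_pi fun x => ?_)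
  split_ifs
  · exact continuous_apply _
  · exact continuous_const
  · exact continuous_const

theorem inner_blockVector_scaledDeviation (Pstar P : Transition S A) (N : ℕ) (s : Fin S)
    (a : Fin A) (w : Fin S → ℝ) :
    √(N : ℝ) * ((P s a : Fin S → ℝ) ⬝ᵥ w - (Pstar s a : Fin S → ℝ) ⬝ᵥ w) =
      inner ℝ (blockVector s a w) (scaledDeviation Pstar N P) := by
  rw [← sub_dotProduct]
  simp only [PiLp.inner_apply, blockVector, scaledDeviation, Fintype.sum_prod_type, dotProduct,
    RCLike.inner_apply, conj_trivial, mul_ite, mul_zero, Finset.mul_sum, Pi.sub_apply]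
  symm
  rw [Finset.sum_eq_single s (by simp +contextual) (by simp),
    Finset.sum_eq_single a (by simp +contextual) (by simp)]
  simp [mul_assoc]

theorem blockVector_dotProduct_mulVec
    (C : Matrix (Fin S × Fin A × Fin S) (Fin S × Fin A × Fin S) ℝ) (s : Fin S) (a : Fin A)
    (w : Fin S → ℝ) :
    (blockVector s a w).ofLp ⬝ᵥ C *ᵥ (blockVector s a w).ofLp =
      w ⬝ᵥ covBlock C s a *ᵥ w := by
  have h : ∀ f : Fin S × Fin A × Fin S → ℝ,
      f ⬝ᵥ (blockVector s a w).ofLp = (fun s' => f (s, a, s')) ⬝ᵥ w := by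
    intro f
    simp only [blockVector, dotProduct, Fintype.sum_prod_type, mul_ite, mul_zero]
    rw [Finset.sum_eq_single s (by simp +contextual) (by simp),
      Finset.sum_eq_single a (by simp +contextual) (by simp)]
    simp
  rw [dotProduct_comm, h, dotProduct_comm]
  congr 1
  ext s'
  rw [Matrix.mulVec, h]
  rfl

variable {Pstar : Transition S A} {post : ℕ → Measure (Transition S A)}
  [∀ N, IsProbabilityMeasure (post N)]
  {C : Matrix (Fin S × Fin A × Fin S) (Fin S × Fin A × Fin S) ℝ}

/-- The vector may vary with `N`, as is needed for `r + γ vhat N`. -/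
theorem tendsto_sqrt_mul_valueAtRisk_dotProduct_sub (hC : C.PosSemidef)
    (hnormal : TendstoInDistribution (fun N => scaledDeviation Pstar N) atTop
      (id : EuclideanSpace ℝ (Fin S × Fin A × Fin S) → _) post (multivariateGaussian 0 C))
    {α : ℝ} (hα0 : 0 < α) (hα1 : α < 1) (s : Fin S) (a : Fin A) {w : ℕ → Fin S → ℝ}
    {w₀ : Fin S → ℝ} (hw : Tendsto w atTop (𝓝 w₀)) :
    Tendsto (fun N : ℕ => √(N : ℝ) *
      (valueAtRisk (post N) α (fun P => (P s a : Fin S → ℝ) ⬝ᵥ w N) -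
        (Pstar s a : Fin S → ℝ) ⬝ᵥ w N)) atTop
      (𝓝 (-stdNormalQuantile (1 - α) * √(w₀ ⬝ᵥ covBlock C s a *ᵥ w₀))) := by
  rw [← blockVector_dotProduct_mulVec]
  exact tendsto_sqrt_mul_valueAtRisk_sub hC hnormal tendsto_id hα0 hα1
    (c := fun N _ => blockVector s a (w N))
    (((continuous_blockVector s a).tendsto w₀).comp (hw.comp tendsto_fst))
    fun N P => inner_blockVector_scaledDeviation Pstar P N s a (w N)

theorem tendsto_of_tendsto_sqrt_mul_sub {f : ℕ → ℝ} {b L : ℝ}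
    (h : Tendsto (fun N : ℕ => √(N : ℝ) * (f N - b)) atTop (𝓝 L)) :
    Tendsto f atTop (𝓝 b) := by
  have hsqrt : Tendsto (fun N : ℕ => √(N : ℝ)) atTop atTop :=
    Real.tendsto_sqrt_atTop.comp tendsto_natCast_atTop_atTop
  have h1 := (hsqrt.inv_tendsto_atTop.mul h).add_const b
  rw [zero_mul, zero_add] at h1
  refine h1.congr' ?_
  filter_upwards [hsqrt.eventually_gt_atTop 0] with N hN
  simp only [Pi.inv_apply]
  field_simp
  ring

/-- The fixed points of the VaR Bellman operators converge to the optimal value function. -/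
theorem tendsto_varBellman_fixedPoint [NeZero A] (hγ0 : 0 ≤ γ) (hγ1 : γ < 1) (hC : C.PosSemidef)
    (hnormal : TendstoInDistribution (fun N => scaledDeviation Pstar N) atTop
      (id : EuclideanSpace ℝ (Fin S × Fin A × Fin S) → _) post (multivariateGaussian 0 C))
    {α : ℝ} (hα0 : 0 < α) (hα1 : α < 1) {vstar : Fin S → ℝ}
    (hvstar : ∀ s, ⨆ a, (Pstar s a : Fin S → ℝ) ⬝ᵥ oneStepValue R γ vstar s a = vstar s)
    {vhat : ℕ → Fin S → ℝ} (hvhat : ∀ N, varBellman R γ (post N) α (vhat N) = vhat N) :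
    Tendsto vhat atTop (𝓝 vstar) := by
  refine tendsto_fixedPoint hγ1 (G := fun N => varBellman R γ (post N) α)
    (Eventually.of_forall fun N => dist_varBellman_le R hγ0 (post N) hα0.le hα1)
    (Eventually.of_forall hvhat) (tendsto_pi_nhds.2 fun s => ?_)
  -- With zero penalty this is just convergence of finite maxima: each VaR tends to the value under
  -- `Pstar`.
  have h := tendsto_iSup_sqrt_mul_add_of_finite (d := fun _ : Fin A => 0) (fun _ => le_rfl)
    ⟨0, rfl⟩ fun a => tendsto_of_tendsto_sqrt_mul_sub
      (tendsto_sqrt_mul_valueAtRisk_dotProduct_sub hC hnormal hα0 hα1 s a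
        (w := fun _ => oneStepValue R γ vstar s a) tendsto_const_nhds)
  simp only [mul_zero, zero_add, Set.ofPred_true, Set.image_univ] at h
  rw [← hvstar s]
  exact h

/-- The scaled errors of the fixed points of the VaR Bellman operators converge to a fixed point of
the limiting Bellman operator over the greedy actions, which bounds the limit from below. -/
theorem exists_tendsto_sqrt_smul_varBellman_fixedPoint_sub [NeZero S] [NeZero A] (hγ0 : 0 ≤ γ)
    (hγ1 : γ < 1) (hC : C.PosSemidef)
    (hnormal : TendstoInDistribution (fun N => scaledDeviation Pstar N) atTop
      (id : EuclideanSpace ℝ (Fin S × Fin A × Fin S) → _) post (multivariateGaussian 0 C))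
    {α : ℝ} (hα0 : 0 < α) (hα1 : α < 1 / 2) {vstar : Fin S → ℝ}
    (hvstar : ∀ s, ⨆ a, (Pstar s a : Fin S → ℝ) ⬝ᵥ oneStepValue R γ vstar s a = vstar s)
    {vhat : ℕ → Fin S → ℝ} (hvhat : ∀ N, varBellman R γ (post N) α (vhat N) = vhat N) :
    ∃ u : Fin S → ℝ, Tendsto (fun N : ℕ => √(N : ℝ) • (vhat N - vstar)) atTop (𝓝 u) ∧
      ∀ s, -(stdNormalQuantile (1 - α) * sigmaMax R γ C vstar) / (1 - γ) ≤ u s := by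
  have hα1' : α < 1 := by linarith
  set q : Fin S → Fin A → ℝ := fun s a => (Pstar s a : Fin S → ℝ) ⬝ᵥ oneStepValue R γ vstar s a
    with hq
  have hqle : ∀ s a, q s a - vstar s ≤ 0 := fun s a => by
    rw [sub_nonpos, ← hvstar s]
    exact le_ciSup (f := q s) (Set.finite_range _).bddAbove a
  have hqeq : ∀ s, ∃ a, q s a - vstar s = 0 := fun s => by
    obtain ⟨a, ha⟩ := exists_eq_ciSup_of_finite (f := q s)
    exact ⟨a, by rw [ha, ← hvstar s, sub_self]⟩
  have hlim := tendsto_varBellman_fixedPoint R hγ0 hγ1 hC hnormal hα0 hα1' hvstar hvhat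
  set c : ℕ → Fin S → Fin A → ℝ := fun N s a => √(N : ℝ) *
    (valueAtRisk (post N) α (fun P => (P s a : Fin S → ℝ) ⬝ᵥ oneStepValue R γ (vhat N) s a) -
      (Pstar s a : Fin S → ℝ) ⬝ᵥ oneStepValue R γ (vhat N) s a) with hc
  set c' : Fin S → Fin A → ℝ := fun s a => -stdNormalQuantile (1 - α) *
    √(oneStepValue R γ vstar s a ⬝ᵥ covBlock C s a *ᵥ oneStepValue R γ vstar s a) with hc'
  have hcc' : ∀ s a, Tendsto (fun N => c N s a) atTop (𝓝 (c' s a)) := fun s a =>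
    tendsto_sqrt_mul_valueAtRisk_dotProduct_sub hC hnormal hα0 hα1' s a
      ((hlim.const_smul γ).const_add _)
  -- The Bellman equation for the scaled error. The VaR correction `c N` is frozen at `vhat N`, so
  -- `G N` depends on `u` only through `γ pᵀ u`. In the limit `G'` only greedy actions remain.
  set G : ℕ → (Fin S → ℝ) → Fin S → ℝ := fun N u s =>
    ⨆ a, (√(N : ℝ) * (q s a - vstar s) + (c N s a + γ * (Pstar s a : Fin S → ℝ) ⬝ᵥ u)) with hG
  set G' : (Fin S → ℝ) → Fin S → ℝ := fun u s =>
    sSup (Set.image (fun a => c' s a + γ * (Pstar s a : Fin S → ℝ) ⬝ᵥ u)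
      {a | q s a - vstar s = 0})
    with hG'
  have hGG' : ∀ u, Tendsto (fun N => G N u) atTop (𝓝 (G' u)) := fun u =>
    tendsto_pi_nhds.2 fun s => tendsto_iSup_sqrt_mul_add_of_finite (hqle s) (hqeq s)
      fun a => (hcc' s a).add_const _
  have hGlip : ∀ N u v, dist (G N u) (G N v) ≤ γ * dist u v := fun N u v => by
    simp only [hG, ← add_assoc]
    exact dist_iSup_add_mul_le _ Pstar hγ0 u v
  have hG'lip : ∀ u v, dist (G' u) (G' v) ≤ γ * dist u v := fun u v =>
    le_of_tendsto ((hGG' u).dist (hGG' v)) (Eventually.of_forall fun N => hGlip N u v)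
  obtain ⟨u, hu⟩ := exists_unique_fixedPoint hγ0 hγ1 hG'lip
  have hu' : G' u = u := (hu u).2 rfl
  have hfix : ∀ N : ℕ, G N (√(N : ℝ) • (vhat N - vstar)) = √(N : ℝ) • (vhat N - vstar) := by
    intro N
    ext s
    have h1 : (√(N : ℝ) • (vhat N - vstar)) s =
        √(N : ℝ) * ((⨆ a, valueAtRisk (post N) α
          (fun P => (P s a : Fin S → ℝ) ⬝ᵥ oneStepValue R γ (vhat N) s a)) - vstar s) := by
      conv_lhs => rw [← hvhat N]
      rfl
    rw [h1, mul_iSup_sub (Set.finite_range _).bddAbove (Real.sqrt_nonneg _)]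
    simp only [hG]
    congr 1
    ext a
    simp only [hc, hq, oneStepValue, dotProduct_add, dotProduct_smul, dotProduct_sub, smul_eq_mul]
    ring
  refine ⟨u, tendsto_fixedPoint hγ1 (Eventually.of_forall hGlip) (Eventually.of_forall hfix) ?_,
    ?_⟩
  · have := hGG' u
    rwa [hu'] at this
  · have hz : 0 ≤ stdNormalQuantile (1 - α) := stdNormalQuantile_nonneg (by linarith)
    -- Minimum principle: at a minimizer of `u`, any greedy action gives `u s₀ ≥ c' s₀ a + γ u s₀`.
    obtain ⟨s₀, hs₀⟩ := Finite.exists_min u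
    obtain ⟨a, ha⟩ := hqeq s₀
    have h1 : c' s₀ a + γ * (Pstar s₀ a : Fin S → ℝ) ⬝ᵥ u ≤ u s₀ := by
      conv_rhs => rw [← hu']
      exact le_csSup (Set.toFinite _).bddAbove ⟨a, ha, rfl⟩
    have h2 : u s₀ ≤ (Pstar s₀ a : Fin S → ℝ) ⬝ᵥ u := le_simplex_dotProduct _ hs₀
    have h3 : -(stdNormalQuantile (1 - α) * sigmaMax R γ C vstar) ≤ c' s₀ a := by
      simp only [hc', neg_mul]
      refine neg_le_neg (mul_le_mul_of_nonneg_left (Real.sqrt_le_sqrt ?_) hz)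
      exact le_ciSup (f := fun x : Fin S × Fin A => oneStepValue R γ vstar x.1 x.2 ⬝ᵥ
        (covBlock C x.1 x.2 *ᵥ oneStepValue R γ vstar x.1 x.2))
        (Set.finite_range _).bddAbove (s₀, a)
    intro s
    refine le_trans ?_ (hs₀ s)
    rw [div_le_iff₀ (by linarith)]
    nlinarith [mul_le_mul_of_nonneg_left h2 hγ0]

theorem continuous_sigmaMax [NeZero S] [NeZero A] (γ : ℝ) : Continuous (sigmaMax R γ C) := by
  have h : ∀ x : Fin S × Fin A, Continuous fun v => oneStepValue R γ v x.1 x.2 ⬝ᵥ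
      (covBlock C x.1 x.2 *ᵥ oneStepValue R γ v x.1 x.2) := fun x => by
    have hw : Continuous fun v => oneStepValue R γ v x.1 x.2 :=
      continuous_const.add (continuous_id.const_smul γ)
    exact hw.dotProduct (continuous_const.matrix_mulVec hw)
  refine Real.continuous_sqrt.comp ?_
  simp only [← Finset.sup'_univ_eq_ciSup]
  exact Continuous.finset_sup'_apply _ fun x _ => h x

/-! ### The optimal percentile return -/

theorem Continuous.tendsto_prod_nhds {ι X Y Z : Type*} [TopologicalSpace X] [TopologicalSpace Y]
    [TopologicalSpace Z] {F : X × Y → Z} (hF : Continuous F) (l : Filter ι) (x : X) (y : Y) :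
    Tendsto (fun p : (ι × X) × Y => F (p.1.2, p.2)) ((l ×ˢ 𝓝 x) ×ˢ 𝓝 y) (𝓝 (F (x, y))) := by
  have h := hF.tendsto (x, y)
  rw [nhds_prod_eq] at h
  exact h.comp ((tendsto_snd.comp tendsto_fst).prodMk tendsto_snd)

theorem exists_tendsto_sqrt_mul_optimalPercentileReturn_sub [NeZero S]
    (p₀ : stdSimplex ℝ (Fin S)) (hγ0 : 0 ≤ γ) (hγ1 : γ < 1) (hC : C.PosSemidef)
    (hnormal : TendstoInDistribution (fun N => scaledDeviation Pstar N) atTop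
      (id : EuclideanSpace ℝ (Fin S × Fin A × Fin S) → _) post (multivariateGaussian 0 C))
    {δ : ℝ} (hδ0 : 0 < δ) (hδ1 : δ < 1 / 2) {vstar : Fin S → ℝ}
    (hvle : ∀ s a, (Pstar s a : Fin S → ℝ) ⬝ᵥ oneStepValue R γ vstar s a ≤ vstar s)
    (hveq : ∀ s, ∃ a, (Pstar s a : Fin S → ℝ) ⬝ᵥ oneStepValue R γ vstar s a = vstar s) :
    ∃ L ≤ 0, Tendsto (fun N : ℕ => √(N : ℝ) *
      (optimalPercentileReturn R p₀ γ (post N) δ - (p₀ : Fin S → ℝ) ⬝ᵥ vstar)) atTop (𝓝 L) := by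
  have hδ1' : δ < 1 := by linarith
  have hz : 0 ≤ stdNormalQuantile (1 - δ) := stdNormalQuantile_nonneg (by linarith)
  set ρ := expectedReturn (A := A) R p₀ γ with hρ
  have hρc := continuous_expectedReturn (A := A) R p₀ hγ0 hγ1
  obtain ⟨B, hB⟩ : ∃ B, ∀ x : Policy S A × Transition S A, |ρ x.1 x.2| ≤ B := by
    obtain ⟨B, hB⟩ := (isCompact_range hρc.abs).bddAbove
    exact ⟨B, fun x => hB ⟨x, rfl⟩⟩
  have hbdd : ∀ N, BddAbove (Set.range fun π => valueAtRisk (post N) δ (ρ π)) := fun N =>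
    ⟨B + 1, by
      rintro _ ⟨π, rfl⟩
      exact valueAtRisk_le hδ0.le hδ1' fun P => hB (π, P)⟩
  obtain ⟨π₀, hπ₀⟩ := exists_policyValue_eq hγ0 hγ1 hveq
  have : Nonempty (Policy S A) := ⟨π₀⟩
  set h' : Policy S A → ℝ := fun π => -stdNormalQuantile (1 - δ) *
    √((returnSlope R p₀ γ Pstar π Pstar).ofLp ⬝ᵥ C *ᵥ
      (returnSlope R p₀ γ Pstar π Pstar).ofLp) with hh'
  have hh'0 : ∀ π, h' π ≤ 0 := fun π =>
    mul_nonpos_of_nonpos_of_nonneg (by linarith) (Real.sqrt_nonneg _)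
  have hsplit : ∀ N : ℕ, √(N : ℝ) * (optimalPercentileReturn R p₀ γ (post N) δ -
      (p₀ : Fin S → ℝ) ⬝ᵥ vstar) = ⨆ π, (√(N : ℝ) * (ρ π Pstar - (p₀ : Fin S → ℝ) ⬝ᵥ vstar) +
        √(N : ℝ) * (valueAtRisk (post N) δ (ρ π) - ρ π Pstar)) := fun N => by
    rw [optimalPercentileReturn, mul_iSup_sub (hbdd N) (Real.sqrt_nonneg _)]
    congr 1
    ext π
    ring
  refine ⟨_, Real.sSup_nonpos ?_, ((tendsto_iSup_sqrt_mul_add (h' := h')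
    (d := fun π => ρ π Pstar - (p₀ : Fin S → ℝ) ⬝ᵥ vstar)
    (h := fun N π => √(N : ℝ) * (valueAtRisk (post N) δ (ρ π) - ρ π Pstar))
    ?_ ?_ ?_ ?_ ?_ ?_).congr fun N => (hsplit N).symm)⟩
  · rintro _ ⟨π, -, rfl⟩
    exact hh'0 π
  · exact (hρc.comp (continuous_id.prodMk continuous_const)).sub continuous_const
  · intro π
    rw [sub_nonpos, hρ, expectedReturn_eq R p₀ hγ0 hγ1]
    exact dotProduct_le_dotProduct_of_nonneg_left
      (fun s => policyValue_le_of_bellman hγ0 hγ1 hvle π s) fun s => stdSimplex.zero_le p₀ s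
  · exact ⟨π₀, by rw [hρ, expectedReturn_eq R p₀ hγ0 hγ1, hπ₀, sub_self]⟩
  · intro π
    -- Indexing by pairs of `N` and a policy gives convergence jointly in both, which the
    -- compactness argument requires.
    refine tendsto_sqrt_mul_valueAtRisk_sub hC hnormal (N := Prod.fst) tendsto_fst hδ0 hδ1'
      (X := fun x : ℕ × Policy S A => ρ x.2) (b := fun x => ρ x.2 Pstar)
      (c := fun x P => returnSlope R p₀ γ Pstar x.2 P) ?_
      fun x P => sqrt_mul_expectedReturn_sub R p₀ hγ0 hγ1 Pstar x.2 P x.1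
    exact (continuous_returnSlope R p₀ hγ0 hγ1 Pstar).tendsto_prod_nhds atTop π Pstar
  · intro N
    obtain ⟨D, hD⟩ := hbdd N
    refine ⟨√(N : ℝ) * (D - (p₀ : Fin S → ℝ) ⬝ᵥ vstar), ?_⟩
    rintro _ ⟨π, rfl⟩
    have := mul_le_mul_of_nonneg_left (hD ⟨π, rfl⟩) (Real.sqrt_nonneg (N : ℝ))
    simp only at this ⊢
    linarith
  · exact ⟨0, by
      rintro _ ⟨π, -, rfl⟩
      exact hh'0 π⟩

end

end

/-! ### Comparison of the two scaled limits -/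

theorem theorem3p5 {S A : ℕ} (hA : 0 < A)
    (R : Fin S → Fin A → Fin S → ℝ) (p₀ : stdSimplex ℝ (Fin S))
    (γ : ℝ) (hγ0 : 0 ≤ γ) (hγ1 : γ < 1)
    (δ : ℝ) (hδ0 : 0 < δ) (hδ1 : δ < 1 / 2)
    (Pstar : Transition S A)
    -- the posterior law of the transition function after `N` observations
    (post : ℕ → Measure (Transition S A)) [∀ N, IsProbabilityMeasure (post N)]
    -- its asymptotic covariance matrix, the (possibly degenerate) inverse Fisher information
    (C : Matrix (Fin S × Fin A × Fin S) (Fin S × Fin A × Fin S) ℝ) (hC : C.PosSemidef)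
    (hnormal : TendstoInDistribution (fun N => scaledDeviation Pstar N) atTop
      (id : EuclideanSpace ℝ (Fin S × Fin A × Fin S) → _) post (multivariateGaussian 0 C)) :
    ∃ vhat : ℕ → Fin S → ℝ,
      (∀ N v, varBellman R γ (post N) (δ / S) v = v ↔ v = vhat N) ∧
      ∃ σ L : ℝ,
        Tendsto (fun N => sigmaMax R γ C (vhat N)) atTop (𝓝 σ) ∧
        Tendsto (fun N : ℕ => √(N : ℝ) *
          (optimalPercentileReturn R p₀ γ (post N) δ - (p₀ : Fin S → ℝ) ⬝ᵥ vhat N))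
          atTop (𝓝 L) ∧
        L ≤ 1 / (1 - γ) * (2 * stdNormalQuantile (1 - δ / S) * σ) ∧
        1 / (1 - γ) * (2 * stdNormalQuantile (1 - δ / S) * σ) ≤
          1 / (1 - γ) * (√(8 * Real.log (S / δ)) * σ) := by
  have : NeZero A := ⟨hA.ne'⟩
  have hS : 0 < S := by
    -- The simplex over an empty state set is empty, so `p₀` forces `S > 0`.
    rcases Nat.eq_zero_or_pos S with rfl | h
    · simpa using stdSimplex.sum_eq_one p₀
    · exact h
  have : NeZero S := ⟨hS.ne'⟩
  have hS1 : (1 : ℝ) ≤ S := Nat.one_le_cast.2 hS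
  set α := δ / S with hα
  have hα0 : 0 < α := by positivity
  have hα1 : α < 1 / 2 := (div_le_self hδ0.le hS1).trans_lt hδ1
  have hα1' : α < 1 := by linarith
  have hγ : 0 < 1 - γ := by linarith
  choose vhat hvhat using fun N => exists_unique_fixedPoint hγ0 hγ1
    (dist_varBellman_le R hγ0 (post N) hα0.le hα1')
  have hfix : ∀ N, varBellman R γ (post N) α (vhat N) = vhat N := fun N => (hvhat N _).2 rfl
  obtain ⟨vstar, hvstar⟩ := exists_unique_fixedPoint hγ0 hγ1
    (G := fun (v : Fin S → ℝ) s => ⨆ a, (Pstar s a : Fin S → ℝ) ⬝ᵥ oneStepValue R γ v s a)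
    fun v u => dist_iSup_le (by positivity)
      (fun s a => simplex_dotProduct_oneStepValue_le R hγ0 (Pstar s a) s a v u)
      fun s a => dist_comm v u ▸ simplex_dotProduct_oneStepValue_le R hγ0 (Pstar s a) s a u v
  have hopt : ∀ s, ⨆ a, (Pstar s a : Fin S → ℝ) ⬝ᵥ oneStepValue R γ vstar s a = vstar s :=
    congrFun ((hvstar vstar).2 rfl)
  obtain ⟨u, hu, hlow⟩ := exists_tendsto_sqrt_smul_varBellman_fixedPoint_sub R hγ0 hγ1 hC hnormal
    hα0 hα1 hopt hfix
  obtain ⟨L, hL0, hL⟩ := exists_tendsto_sqrt_mul_optimalPercentileReturn_sub R p₀ hγ0 hγ1 hC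
    hnormal hδ0 hδ1 (vstar := vstar)
    (fun s a => (le_ciSup (f := fun a => (Pstar s a : Fin S → ℝ) ⬝ᵥ oneStepValue R γ vstar s a)
      (Set.finite_range _).bddAbove a).trans_eq (hopt s))
    (fun s => (exists_eq_ciSup_of_finite (f := fun a => (Pstar s a : Fin S → ℝ) ⬝ᵥ
      oneStepValue R γ vstar s a)).imp fun a ha => ha.trans (hopt s))
  have hσ0 : 0 ≤ sigmaMax R γ C vstar := Real.sqrt_nonneg _
  have hz : 0 ≤ stdNormalQuantile (1 - α) := stdNormalQuantile_nonneg (by linarith)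
  refine ⟨vhat, hvhat, sigmaMax R γ C vstar, L - (p₀ : Fin S → ℝ) ⬝ᵥ u, ?_, ?_, ?_, ?_⟩
  · exact ((continuous_sigmaMax R γ).tendsto vstar).comp
      (tendsto_varBellman_fixedPoint R hγ0 hγ1 hC hnormal hα0 hα1' hopt hfix)
  · have hdot : Continuous fun x : Fin S → ℝ => (p₀ : Fin S → ℝ) ⬝ᵥ x :=
      continuous_const.dotProduct continuous_id
    refine (hL.sub ((hdot.tendsto u).comp hu)).congr fun N => ?_
    simp only [Function.comp_apply, dotProduct_smul, dotProduct_sub, smul_eq_mul]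
    ring
  -- Here `L ≤ 0` and the lower bound on `u` give half of the claimed bound; doubling is free since
  -- that bound is nonnegative.
  · have h1 := le_simplex_dotProduct p₀ hlow
    have h2 : 0 ≤ stdNormalQuantile (1 - α) * sigmaMax R γ C vstar / (1 - γ) := by positivity
    have h3 : 1 / (1 - γ) * (2 * stdNormalQuantile (1 - α) * sigmaMax R γ C vstar) =
        2 * (stdNormalQuantile (1 - α) * sigmaMax R γ C vstar / (1 - γ)) := by ring
    rw [neg_div] at h1
    linarith
  · have h1 := stdNormalQuantile_le_sqrt_log hα0 hα1'
    have h2 : √(8 * Real.log (S / δ)) = 2 * √(2 * Real.log (1 / α)) := by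
      rw [hα, one_div_div, show 8 * Real.log (S / δ) = 2 ^ 2 * (2 * Real.log (S / δ)) by ring,
        Real.sqrt_mul (by positivity), Real.sqrt_sq (by norm_num)]
    rw [h2]
    gcongr
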